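/- Let $G$ be a group and let $A$ be a semilattice of abelian groups, that is, a commutative inverse semigroup. Let $\theta=\{\theta_x:\mathcal D_{x^{-1}}\to\mathcal D_x\}_{x\in G}$ be a partial action of $G$ on $A$: the $\mathcal D_x$ are non-empty ideals of $A$, the $\theta_x$ are isomorphisms, $\mathcal D_1=A$, $\theta_1=\mathrm{id}_A$, $\theta_x(\mathcal D_{x^{-1}}\cap\mathcal D_y)=\mathcal D_x\cap\mathcal D_{xy}$, and $\theta_x(\theta_y(s))=\theta_{xy}(s)$ for $s\in\mathcal D_{y^{-1}}\cap\mathcal D_{y^{-1}x^{-1}}$. (Then $(A,\theta)$ is called a partial $G$-module.) *Cohomology.* A multiplier of a semigroup $S$ is a pair $w$ of maps $s\mapsto ws$, $s\mapsto sw$ from $S$ to $S$ with $w(st)=(ws)t$, $(st)w=s(tw)$, $s(wt)=(sw)t$; multipliers form a monoid $\mathcal M(S)$ under composition, with group of units $\mathcal U(\mathcal M(S))$. Let $C^1(G,A)=\prod_{x}\mathcal U(\mathcal M(\mathcal D_x))$, $C^2(G,A)=\prod_{x,y}\mathcal U(\mathcal M(\mathcal D_x\cap\mathcal D_{xy}))$,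 $C^3(G,A)=\prod_{x,y,z}\mathcal U(\mathcal M(\mathcal D_x\cap\mathcal D_{xy}\cap\mathcal D_{xyz}))$, and define homomorphisms of abelian groups $\delta^1:C^1(G,A)\to C^2(G,A)$, $\delta^2:C^2(G,A)\to C^3(G,A)$ by $$(\delta^1\varepsilon)(x,y)a=\theta_x(\theta_{x^{-1}}(a)\varepsilon(y))\,\varepsilon(xy)^{-1}\varepsilon(x),$$ $$(\delta^2w)(x,y,z)a=\theta_x(\theta_{x^{-1}}(a)w(y,z))\,w(xy,z)^{-1}w(x,yz)w(x,y)^{-1}.$$ Put $H^2(G,A)=\ker\delta^2/\operatorname{im}\delta^1$. A twisting related to $(A,\theta)$ is $w\in\ker\delta^2$ with $w(1,x)=w(x,1)=\mathrm{id}_{\mathcal D_x}$ for all $x\in G$. For such $w$ let $A*_{(\theta,w)}G=\{a\delta_x\mid x\in G,\ a\in\mathcal D_x\}$ with $a\delta_x\cdot b\delta_y=\theta_x(\theta_x^{-1}(a)b)w(x,y)\,\delta_{xy}$, together with the maps $i(a)=a\delta_1$ and $j(a\delta_x)=x$. *Extensions.* An extension of $A$ by $G$ is an inverse semigroup $U$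 with an injective homomorphism $i:A\to U$ and a surjective homomorphism $j:U\to G$ such that $i(A)=j^{-1}(1)$. Two extensions $(U,i,j)$ and $(U',i',j')$ are equivalent if there is an isomorphism $\mu:U\to U'$ with $\mu\circ i=i'$ and $j'\circ\mu=j$. A refinement of $(U,i,j)$ consists of an $E$-unitary inverse semigroup $S$ and surjective homomorphisms $\pi:U\to S$, $\kappa:S\to G$ such that $\pi$ is injective on idempotents, $i(A)=\pi^{-1}(E(S))$ and $j=\kappa\circ\pi$, where $E(S)$ denotes the set of idempotents of $S$. An order-preserving transversal of $\pi$ is a map $\rho:S\to U$ with $\pi\circ\rho=\mathrm{id}_S$, $\rho(E(S))\subseteq E(U)$, and $\rho(s)\le\rho(t)$ whenever $s\le t$ in the natural partial order. An extension is admissible if it has a refinement with an order-preserving transversal. A refinement and an order-preserving transversal $\rho$ induce on $A$ the partial action of $G$ with domains $\{a\in A\mid \exists s\in\kappa^{-1}(x):\ i(aa^{-1})=\rho(ss^{-1})\}$, $x\in G$, whose isomorphism at $x$ sends $a$ to $i^{-1}(\rho(s)i(a)\rho(s)^{-1})$, where $s\in\kappa^{-1}(x)$ is such that $\rho(s^{-1}s)=i(aa^{-1})$.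 An extension of $(A,\theta)$ by $G$ is an admissible extension of $A$ by $G$ for which the induced partial action is $\theta$. **Theorem.** Every class in $H^2(G,A)$ is the class $[w]$ of some twisting $w$ related to $(A,\theta)$. For every such twisting $w$ the crossed product $A*_{(\theta,w)}G$, with the maps $i$ and $j$ above, is an extension of $(A,\theta)$ by $G$, and $[w]\mapsto[A*_{(\theta,w)}G]$ is a well-defined bijection from $H^2(G,A)$ onto the set of equivalence classes of extensions of $(A,\theta)$ by $G$. -/

import Mathlib

universe u v

/-! ### Inverse semigroups -/

/-- Every element `s` has a unique inverse, i.e. a unique `t` with `sts = s` and `tst = t`. -/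
class IsInverseSemigroup (S : Type u) [Semigroup S] : Prop where
  existsUnique_inverse : ∀ s : S, ∃! t : S, s * t * s = s ∧ t * s * t = t

/-- The inverse `s⁻¹` of an element of an inverse semigroup. -/
noncomputable def sinv {S : Type u} [Semigroup S] [IsInverseSemigroup S] (s : S) : S :=
  (IsInverseSemigroup.existsUnique_inverse s).choose

theorem mul_sinv_mul {S : Type u} [Semigroup S] [IsInverseSemigroup S] (s : S) :
    s * sinv s * s = s :=
  (IsInverseSemigroup.existsUnique_inverse s).choose_spec.1.1

theorem sinv_mul_sinv {S : Type u} [Semigroup S] [IsInverseSemigroup S] (s : S) :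
    sinv s * s * sinv s = sinv s :=
  (IsInverseSemigroup.existsUnique_inverse s).choose_spec.1.2

/-- The natural partial order: `s ≤ t` iff `s = e t` for some idempotent `e`. -/
def NatLE {S : Type u} [Semigroup S] (s t : S) : Prop :=
  ∃ e : S, IsIdempotentElem e ∧ s = e * t

/-- `S` is `E`-unitary: an element above an idempotent is an idempotent. -/
def IsEUnitary (S : Type u) [Semigroup S] : Prop :=
  ∀ e s : S, IsIdempotentElem e → NatLE e s → IsIdempotentElem s

/-- A (von Neumann) regular semigroup. -/
class IsRegularSemigroup (S : Type u) [Semigroup S] : Prop where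
  exists_inverse : ∀ s : S, ∃ t : S, s * t * s = s

/-- Non-empty two-sided ideals of a semigroup. -/
structure IsSemigroupIdeal {A : Type u} [Semigroup A] (I : Subsemigroup A) : Prop where
  nonempty : ∃ a, a ∈ I
  mul_mem_left : ∀ a b : A, b ∈ I → a * b ∈ I
  mul_mem_right : ∀ a b : A, a ∈ I → a * b ∈ I

theorem IsSemigroupIdeal.inf {A : Type u} [Semigroup A] {I J : Subsemigroup A}
    (hI : IsSemigroupIdeal I) (hJ : IsSemigroupIdeal J) : IsSemigroupIdeal (I ⊓ J) where
  nonempty := by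
    obtain ⟨a, ha⟩ := hI.nonempty
    obtain ⟨b, hb⟩ := hJ.nonempty
    exact ⟨a * b, hI.mul_mem_right a b ha, hJ.mul_mem_left a b hb⟩
  mul_mem_left a b h := ⟨hI.mul_mem_left a b h.1, hJ.mul_mem_left a b h.2⟩
  mul_mem_right a b h := ⟨hI.mul_mem_right a b h.1, hJ.mul_mem_right a b h.2⟩

theorem IsSemigroupIdeal.isRegularSemigroup {A : Type u} [Semigroup A] [IsInverseSemigroup A]
    {I : Subsemigroup A} (hI : IsSemigroupIdeal I) : IsRegularSemigroup I where
  exists_inverse s := by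
    refine ⟨⟨sinv (s : A) * s * sinv (s : A), ?_⟩, ?_⟩
    · exact hI.mul_mem_right _ _ (hI.mul_mem_left _ _ s.2)
    · apply Subtype.ext
      change (s : A) * (sinv (s : A) * s * sinv (s : A)) * s = s
      rw [sinv_mul_sinv, mul_sinv_mul]

/-! ### Multipliers -/

/-- A multiplier `w` of a semigroup `S`: a pair of maps `left : s ↦ ws` and `right : s ↦ sw`. -/
@[ext]
structure Multiplier (S : Type u) [Semigroup S] where
  left : S → S
  right : S → S
  left_mul : ∀ s t : S, left (s * t) = left s * t
  right_mul : ∀ s t : S, right (s * t) = s * right t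
  linked : ∀ s t : S, s * left t = right s * t

namespace Multiplier

/-- Multipliers form a monoid: `(ww')s = w(w's)` and `s(ww') = (sw)w'`. -/
instance instMonoid (S : Type u) [Semigroup S] : Monoid (Multiplier S) where
  mul w w' :=
    { left := fun s => w.left (w'.left s)
      right := fun s => w'.right (w.right s)
      left_mul := fun s t => by rw [w'.left_mul, w.left_mul]
      right_mul := fun s t => by rw [w.right_mul, w'.right_mul]
      linked := fun s t => by rw [w.linked, w'.linked] }
  one :=
    { left := fun s => s
      right := fun s => s
      left_mul := fun _ _ => rfl
      right_mul := fun _ _ => rfl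
      linked := fun _ _ => rfl }
  mul_assoc _ _ _ := rfl
  one_mul _ := rfl
  mul_one _ := rfl

theorem left_eq_right {S : Type u} [CommSemigroup S] [IsRegularSemigroup S] (w : Multiplier S)
    (s : S) : w.left s = w.right s := by
  obtain ⟨t, ht⟩ := IsRegularSemigroup.exists_inverse s
  have h1 : w.left s = w.left s * t * s := by
    rw [← w.left_mul, ← w.left_mul, ht]
  have h2 : w.right s = s * t * w.right s := by
    rw [← w.right_mul, ht]
  rw [h1, h2, mul_assoc, mul_comm t s, mul_comm, mul_assoc, mul_comm t, ← mul_assoc, w.linked,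
    mul_assoc, mul_comm, mul_comm s t]

/-- Multipliers of a commutative regular semigroup commute. -/
instance instCommMonoid (S : Type u) [CommSemigroup S] [IsRegularSemigroup S] :
    CommMonoid (Multiplier S) where
  toMonoid := instMonoid S
  mul_comm w w' := by
    have key : ∀ (w w' : Multiplier S) (s : S), w.left (w'.left s) = w'.left (w.left s) := by
      intro w w' s
      obtain ⟨t, ht⟩ := IsRegularSemigroup.exists_inverse s
      have e : ∀ v v' : Multiplier S, v.left (v'.left s) = v.left s * v'.left (t * s) := by
        intro v v'
        have : v'.left s = s * v'.left (t * s) := by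
          conv_lhs => rw [← ht, mul_assoc, v'.left_mul, left_eq_right v' s, ← v'.linked]
        rw [this, v.left_mul]
      have f : ∀ v : Multiplier S, v.left (t * s) = v.left s * t := by
        intro v
        rw [mul_comm, v.left_mul]
      rw [e w w', e w' w, f, f, ← mul_assoc, ← mul_assoc, mul_comm (w.left s)]
    apply Multiplier.ext
    · funext s
      exact key w w' s
    · funext s
      change w'.right (w.right s) = w.right (w'.right s)
      rw [← left_eq_right, ← left_eq_right, ← left_eq_right, ← left_eq_right, key]

theorem units_aux₁ {S : Type u} [CommSemigroup S] [IsRegularSemigroup S]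
    (a a' b b' c c' : (Multiplier S)ˣ) :
    a * a' * (b * b')⁻¹ * (c * c') = a * b⁻¹ * c * (a' * b'⁻¹ * c') := by
  rw [mul_inv, mul_mul_mul_comm a a', mul_mul_mul_comm]

theorem units_aux₂ {S : Type u} [CommSemigroup S] [IsRegularSemigroup S]
    (a a' b b' c c' d d' : (Multiplier S)ˣ) :
    a * a' * (b * b')⁻¹ * (c * c') * (d * d')⁻¹ =
      a * b⁻¹ * c * d⁻¹ * (a' * b'⁻¹ * c' * d'⁻¹) := by
  rw [units_aux₁, mul_inv, mul_mul_mul_comm]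

/-- Restriction of multipliers of `I` to a smaller ideal `J` of `A`. -/
def restrict {A : Type u} [Semigroup A] [IsInverseSemigroup A] {I J : Subsemigroup A}
    (hJI : J ≤ I) (hJ : IsSemigroupIdeal J) : Multiplier I →* Multiplier J where
  toFun w :=
    { left := fun a => ⟨w.left ⟨a, hJI a.2⟩, by
        have h : (⟨a, hJI a.2⟩ : I) =
            ⟨a, hJI a.2⟩ * ⟨sinv (a : A) * a, hJI (hJ.mul_mem_left _ _ a.2)⟩ :=
          Subtype.ext (by simp [← mul_assoc, mul_sinv_mul])
        rw [h, w.left_mul]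
        exact hJ.mul_mem_left _ _ (hJ.mul_mem_left _ _ a.2)⟩
      right := fun a => ⟨w.right ⟨a, hJI a.2⟩, by
        have h : (⟨a, hJI a.2⟩ : I) =
            ⟨a * sinv (a : A), hJI (hJ.mul_mem_right _ _ a.2)⟩ * ⟨a, hJI a.2⟩ :=
          Subtype.ext (by simp [mul_sinv_mul])
        rw [h, w.right_mul]
        exact hJ.mul_mem_right _ _ (hJ.mul_mem_right _ _ a.2)⟩
      left_mul := fun s t =>
        Subtype.ext (by
        have h := congrArg Subtype.val (w.left_mul ⟨s, hJI s.2⟩ ⟨t, hJI t.2⟩)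
        exact h)
      right_mul := fun s t =>
        Subtype.ext (by
        have h := congrArg Subtype.val (w.right_mul ⟨s, hJI s.2⟩ ⟨t, hJI t.2⟩)
        exact h)
      linked := fun s t =>
        Subtype.ext (by
        have h := congrArg Subtype.val (w.linked ⟨s, hJI s.2⟩ ⟨t, hJI t.2⟩)
        exact h) }
  map_one' := rfl
  map_mul' _ _ := rfl

/-- Transport of multipliers along an isomorphism `e`: `a ↦ e(w e⁻¹(a))`, `a ↦ e(e⁻¹(a) w)`. -/
def conj {S T : Type u} [Semigroup S] [Semigroup T] (e : S ≃* T) :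
    Multiplier S →* Multiplier T where
  toFun w :=
    { left := fun a => e (w.left (e.symm a))
      right := fun a => e (w.right (e.symm a))
      left_mul := fun s t => by rw [map_mul, w.left_mul, map_mul, e.apply_symm_apply]
      right_mul := fun s t => by rw [map_mul, w.right_mul, map_mul, e.apply_symm_apply]
      linked := fun s t => by
        have h := congrArg e (w.linked (e.symm s) (e.symm t))
        simpa only [map_mul, e.apply_symm_apply] using h }
  map_one' := Multiplier.ext (funext fun a => e.apply_symm_apply a)
    (funext fun a => e.apply_symm_apply a)
  map_mul' w w' := Multiplier.ext
    (funext fun a => congrArg (fun b => e (w.left b)) (e.symm_apply_apply _).symm)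
    (funext fun a => congrArg (fun b => e (w'.right b)) (e.symm_apply_apply _).symm)

end Multiplier

/-! ### Partial actions -/

/-- A partial action of a group `G` on a semigroup `A` (used for `A` an inverse semigroup):
isomorphisms `θ x : D x⁻¹ → D x` between non-empty ideals of `A`. -/
structure PartialAction (G : Type v) (A : Type u) [Group G] [Semigroup A] where
  D : G → Subsemigroup A
  isIdeal : ∀ x, IsSemigroupIdeal (D x)
  θ : ∀ x, D x⁻¹ ≃* D x
  D_one : D 1 = ⊤
  θ_one : ∀ a : D 1⁻¹, (θ 1 a : A) = a
  image_inter : ∀ x y,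
    (fun a : D x⁻¹ => (θ x a : A)) '' {a | (a : A) ∈ D y} = (D x : Set A) ∩ D (x * y)
  θ_comp : ∀ (x y : G) (s : A) (h₁ : s ∈ D y⁻¹) (h₂ : s ∈ D (x * y)⁻¹)
    (h₃ : (θ y ⟨s, h₁⟩ : A) ∈ D x⁻¹), (θ x ⟨θ y ⟨s, h₁⟩, h₃⟩ : A) = θ (x * y) ⟨s, h₂⟩

namespace PartialAction

section
variable {G : Type v} {A : Type u} [Group G] [CommSemigroup A] (θ : PartialAction G A)

theorem mem_iff (x y : G) (a : θ.D x⁻¹) : (a : A) ∈ θ.D y ↔ (θ.θ x a : A) ∈ θ.D (x * y) := by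
  constructor
  · intro h
    have : (θ.θ x a : A) ∈ (θ.D x : Set A) ∩ θ.D (x * y) := by
      rw [← θ.image_inter]
      exact ⟨a, h, rfl⟩
    exact this.2
  · intro h
    have : (θ.θ x a : A) ∈ (θ.D x : Set A) ∩ θ.D (x * y) := ⟨(θ.θ x a).2, h⟩
    rw [← θ.image_inter] at this
    obtain ⟨b, hb, hab⟩ := this
    have : b = a := (θ.θ x).injective (Subtype.ext hab)
    exact this ▸ hb

/-- The domain of values of 2-cochains, `D_{(x,y)} = D_x D_{xy} = D_x ∩ D_{xy}`
(products and intersections of non-empty ideals of an inverse semigroup agree). -/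
def D₂ (x y : G) : Subsemigroup A := θ.D x ⊓ θ.D (x * y)

/-- `D_{(x,y,z)} = D_x D_{xy} D_{xyz} = D_x ∩ D_{xy} ∩ D_{xyz}`. -/
def D₃ (x y z : G) : Subsemigroup A := θ.D x ⊓ (θ.D (x * y) ⊓ θ.D (x * y * z))

theorem D₃_le₁ (x y z : G) : θ.D₃ x y z ≤ θ.D₂ (x * y) z := inf_le_right

theorem D₃_le₂ (x y z : G) : θ.D₃ x y z ≤ θ.D₂ x (y * z) := by
  rw [D₂, ← mul_assoc]
  exact inf_le_inf_left _ inf_le_right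

theorem D₃_le₃ (x y z : G) : θ.D₃ x y z ≤ θ.D₂ x y :=
  inf_le_inf_left _ inf_le_left

theorem isIdeal₂ (x y : G) : IsSemigroupIdeal (θ.D₂ x y) :=
  (θ.isIdeal _).inf (θ.isIdeal _)

theorem isIdeal₃ (x y z : G) : IsSemigroupIdeal (θ.D₃ x y z) :=
  (θ.isIdeal _).inf ((θ.isIdeal _).inf (θ.isIdeal _))

/-- The isomorphism `D_{x⁻¹} ∩ I ≃ D_x ∩ J` induced by `θ_x` when `θ_x` matches `I` with `J`. -/
def restrictEquiv (x : G) (I J : Subsemigroup A)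
    (h : ∀ a : θ.D x⁻¹, (a : A) ∈ I ↔ (θ.θ x a : A) ∈ J) :
    (θ.D x⁻¹ ⊓ I : Subsemigroup A) ≃* (θ.D x ⊓ J : Subsemigroup A) where
  toFun a := ⟨θ.θ x ⟨a, a.2.1⟩, (θ.θ x ⟨a, a.2.1⟩).2, (h _).1 a.2.2⟩
  invFun b := ⟨(θ.θ x).symm ⟨b, b.2.1⟩, ((θ.θ x).symm ⟨b, b.2.1⟩).2, (h _).2 (by
    rw [MulEquiv.apply_symm_apply]
    exact b.2.2)⟩
  left_inv a := by
    apply Subtype.ext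
    simp
  right_inv b := by
    apply Subtype.ext
    simp
  map_mul' a b := Subtype.ext (by
    have h := congrArg Subtype.val (map_mul (θ.θ x) ⟨a, a.2.1⟩ ⟨b, b.2.1⟩)
    exact h)

end

section
variable {G : Type v} {A : Type u} [Group G] [CommSemigroup A] [IsInverseSemigroup A]
  (θ : PartialAction G A)

instance instRegular₁ (x : G) : IsRegularSemigroup (θ.D x) := (θ.isIdeal x).isRegularSemigroup

instance instRegular₂ (x y : G) : IsRegularSemigroup (θ.D₂ x y) :=
  (θ.isIdeal₂ x y).isRegularSemigroup

instance instRegular₃ (x y z : G) : IsRegularSemigroup (θ.D₃ x y z) :=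
  (θ.isIdeal₃ x y z).isRegularSemigroup

/-! ### Cochains, cocycles and the second partial cohomology group -/

/-- Partial 1-cochains: families of invertible multipliers of `D_x`. -/
abbrev C₁ : Type (max u v) := ∀ x : G, (Multiplier (θ.D x))ˣ

/-- Partial 2-cochains: families of invertible multipliers of `D_{(x,y)}`. -/
abbrev C₂ : Type (max u v) := ∀ x y : G, (Multiplier (θ.D₂ x y))ˣ

/-- Partial 3-cochains: families of invertible multipliers of `D_{(x,y,z)}`. -/
abbrev C₃ : Type (max u v) := ∀ x y z : G, (Multiplier (θ.D₃ x y z))ˣ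

/-- Restriction of invertible multipliers to a smaller ideal. -/
def res {I J : Subsemigroup A} (hJI : J ≤ I) (hJ : IsSemigroupIdeal J) :
    (Multiplier I)ˣ →* (Multiplier J)ˣ :=
  Units.map (Multiplier.restrict hJI hJ)

/-- `w ↦ (a ↦ θ_x(θ_{x⁻¹}(a) w))`, from multipliers of `D_y` to multipliers of `D_{(x,y)}`. -/
def act₁ (x y : G) : (Multiplier (θ.D y))ˣ →* (Multiplier (θ.D₂ x y))ˣ :=
  (Units.map (Multiplier.conj (θ.restrictEquiv x (θ.D y) (θ.D (x * y)) (θ.mem_iff x y)))).comp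
    (res inf_le_right ((θ.isIdeal x⁻¹).inf (θ.isIdeal y)))

/-- `w ↦ (a ↦ θ_x(θ_{x⁻¹}(a) w))`, from multipliers of `D_{(y,z)}` to multipliers of
`D_{(x,y,z)}`. -/
def act₂ (x y z : G) : (Multiplier (θ.D₂ y z))ˣ →* (Multiplier (θ.D₃ x y z))ˣ :=
  (Units.map (Multiplier.conj (θ.restrictEquiv x (θ.D₂ y z)
      (θ.D (x * y) ⊓ θ.D (x * y * z)) (fun a => by
        rw [D₂, Subsemigroup.mem_inf, Subsemigroup.mem_inf, mul_assoc]
        exact and_congr (θ.mem_iff x y a) (θ.mem_iff x (y * z) a))))).comp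
    (res inf_le_right ((θ.isIdeal x⁻¹).inf (θ.isIdeal₂ y z)))

/-- `(δ¹ε)(x,y) a = θ_x(θ_{x⁻¹}(a) ε(y)) ε(xy)⁻¹ ε(x)`. -/
def δ₁ : θ.C₁ →* θ.C₂ where
  toFun ε x y :=
    θ.act₁ x y (ε y) *
      (res (J := θ.D₂ x y) inf_le_right (θ.isIdeal₂ x y) (ε (x * y)))⁻¹ *
      res (J := θ.D₂ x y) inf_le_left (θ.isIdeal₂ x y) (ε x)
  map_one' := by
    funext x y
    simp
  map_mul' ε ε' := by
    funext x y
    simp only [Pi.mul_apply, map_mul]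
    exact Multiplier.units_aux₁ _ _ _ _ _ _

/-- `(δ²w)(x,y,z) a = θ_x(θ_{x⁻¹}(a) w(y,z)) w(xy,z)⁻¹ w(x,yz) w(x,y)⁻¹`. -/
def δ₂ : θ.C₂ →* θ.C₃ where
  toFun w x y z :=
    θ.act₂ x y z (w y z) *
      (res (θ.D₃_le₁ x y z) (θ.isIdeal₃ x y z) (w (x * y) z))⁻¹ *
      res (θ.D₃_le₂ x y z) (θ.isIdeal₃ x y z) (w x (y * z)) *
      (res (θ.D₃_le₃ x y z) (θ.isIdeal₃ x y z) (w x y))⁻¹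
  map_one' := by
    funext x y z
    simp
  map_mul' w w' := by
    funext x y z
    simp only [Pi.mul_apply, map_mul]
    exact Multiplier.units_aux₂ _ _ _ _ _ _ _ _

/-- Partial 2-cocycles. -/
def Z₂ : Subgroup θ.C₂ := θ.δ₂.ker

/-- Partial 2-coboundaries. -/
def B₂ : Subgroup θ.C₂ := θ.δ₁.range

instance instNormal : (θ.B₂.subgroupOf θ.Z₂).Normal where
  conj_mem w hw u := by
    have h : u * w * u⁻¹ = w := by
      rw [mul_inv_eq_iff_eq_mul]
      apply Subtype.ext
      funext x y
      exact mul_comm (G := (Multiplier (θ.D₂ x y))ˣ) _ _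
    rwa [h]

/-- The second partial cohomology group `H²(G,A) = Z²(G,A) / B²(G,A)`. -/
abbrev H₂ : Type (max u v) := θ.Z₂ ⧸ θ.B₂.subgroupOf θ.Z₂

/-- The class `[w]` of a partial 2-cocycle. -/
def H₂.mk (w : θ.Z₂) : θ.H₂ := QuotientGroup.mk w

/-- A twisting related to `(A, θ)`: a partial 2-cocycle `w` with
`w(1,x) = w(x,1) = id` for all `x`. -/
def IsTwisting (w : θ.C₂) : Prop :=
  w ∈ θ.Z₂ ∧ ∀ x : G, w 1 x = 1 ∧ w x 1 = 1

/-! ### The crossed product -/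

/-- The crossed product `A *_{(θ,w)} G`, whose elements are `a δ_x` with `a ∈ D_x`. -/
structure CrossedProduct (w : θ.C₂) : Type (max u v) where
  deg : G
  coef : θ.D deg

/-- `θ_x(θ_x⁻¹(a) b)` as an element of `D_{(x,y)}`, for `a ∈ D_x` and `b ∈ D_y`. -/
def twistedMul {x y : G} (a : θ.D x) (b : θ.D y) : θ.D₂ x y :=
  θ.restrictEquiv x (θ.D y) (θ.D (x * y)) (θ.mem_iff x y)
    ⟨((θ.θ x).symm a : A) * b, (θ.isIdeal x⁻¹).mul_mem_right _ _ ((θ.θ x).symm a).2,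
      (θ.isIdeal y).mul_mem_left _ _ b.2⟩

/-- `a δ_x · b δ_y = θ_x(θ_x⁻¹(a) b) w_{x,y} δ_{xy}`. -/
instance instMulCrossedProduct (w : θ.C₂) : Mul (θ.CrossedProduct w) where
  mul u v :=
    { deg := u.deg * v.deg
      coef := ⟨(w u.deg v.deg).val.right (θ.twistedMul u.coef v.coef),
        ((w u.deg v.deg).val.right (θ.twistedMul u.coef v.coef)).2.2⟩ }

/-- The embedding `a ↦ a δ_1` of `A` into the crossed product. -/
def CrossedProduct.incl (w : θ.C₂) (a : A) : θ.CrossedProduct w where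
  deg := 1
  coef := ⟨a, by rw [θ.D_one]; trivial⟩

end

end PartialAction

/-! ### Extensions of semilattices of abelian groups by groups -/

/-- An extension `A → U → G` of `A` by a group `G`. -/
structure GroupExt (A : Type u) (G : Type v) [CommSemigroup A] [Group G] where
  U : Type (max u v)
  [semigroup : Semigroup U]
  [isInverse : IsInverseSemigroup U]
  i : A →ₙ* U
  j : U →ₙ* G
  i_injective : Function.Injective i
  j_surjective : Function.Surjective j
  range_i : Set.range i = {u | j u = 1}

attribute [instance] GroupExt.semigroup GroupExt.isInverse

namespace GroupExt

section
variable {A : Type u} {G : Type v} [CommSemigroup A] [Group G]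

/-- Equivalence of extensions: an isomorphism `U ≅ U'` compatible with `A` and `G`. -/
def Equivalent (E E' : GroupExt A G) : Prop :=
  ∃ μ : E.U ≃* E'.U, (∀ a, μ (E.i a) = E'.i a) ∧ ∀ u, E'.j (μ u) = E.j u

/-- A refinement `A → U → S → G` of an extension `A → U → G`: the semigroup `S` is an
`E`-unitary inverse semigroup, `A → U → S` is an extension of `A` by `S` (`π` is surjective,
injective on idempotents, and `i(A) = π⁻¹(E(S))`), and `j = κ ∘ π`. -/
structure Refinement (E : GroupExt A G) where
  S : Type (max u v)
  [semigroup : Semigroup S]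
  [isInverse : IsInverseSemigroup S]
  isEUnitary : IsEUnitary S
  π : E.U →ₙ* S
  κ : S →ₙ* G
  π_surjective : Function.Surjective π
  κ_surjective : Function.Surjective κ
  π_idempotent_separating : ∀ e f : E.U, IsIdempotentElem e → IsIdempotentElem f →
    π e = π f → e = f
  range_i : Set.range E.i = {u | IsIdempotentElem (π u)}
  j_eq : ∀ u, E.j u = κ (π u)

attribute [instance] Refinement.semigroup Refinement.isInverse

/-- An order-preserving transversal `ρ : S → U` of `π`. -/
structure Refinement.IsOrderPreservingTransversal {E : GroupExt A G} (R : E.Refinement)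
    (ρ : R.S → E.U) : Prop where
  π_comp : ∀ s, R.π (ρ s) = s
  map_idempotent : ∀ e, IsIdempotentElem e → IsIdempotentElem (ρ e)
  monotone : ∀ s t, NatLE s t → NatLE (ρ s) (ρ t)

/-- An extension is admissible if the map `π` of a refinement (refinements exist and are unique
up to isomorphism) has an order-preserving transversal. -/
def IsAdmissible (E : GroupExt A G) : Prop :=
  ∃ (R : E.Refinement) (ρ : R.S → E.U), R.IsOrderPreservingTransversal ρ

variable [IsInverseSemigroup A]

/-- The partial action `θ` is the one that is induced by a refinement and a transversal `ρ`.
With `α(e) = i⁻¹(ρ(e))` and `λ_s(a) = i⁻¹(ρ(s) i(a) ρ(s)⁻¹)`, the domain `D_x` is the union of the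
group components `A_{α(ss⁻¹)} = {a | a a⁻¹ = α(ss⁻¹)}` over `s ∈ κ⁻¹(x)`, and
`θ_x(a) = λ_s(a)` for `s ∈ κ⁻¹(x)` with `α(s⁻¹s) = a a⁻¹`. As `i` is injective, these conditions
are stated after applying `i`. -/
structure Refinement.Induces {E : GroupExt A G} (R : E.Refinement) (ρ : R.S → E.U)
    (θ : PartialAction G A) : Prop where
  mem_D_iff : ∀ (x : G) (a : A),
    a ∈ θ.D x ↔ ∃ s : R.S, R.κ s = x ∧ E.i (a * sinv a) = ρ (s * sinv s)
  θ_apply : ∀ (x : G) (a : θ.D x⁻¹) (s : R.S), R.κ s = x →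
    E.i ((a : A) * sinv (a : A)) = ρ (sinv s * s) →
    E.i (θ.θ x a : A) = ρ s * E.i a * sinv (ρ s)

/-- `E` is an extension of the partial `G`-module `(A, θ)` by `G`: it is admissible (a refinement
has an order-preserving transversal) and the induced partial action is `θ`. -/
def IsExtensionOf (E : GroupExt A G) (θ : PartialAction G A) : Prop :=
  ∃ (R : E.Refinement) (ρ : R.S → E.U), R.IsOrderPreservingTransversal ρ ∧ R.Induces ρ θ

end

end GroupExt

namespace PartialAction

section
variable {G : Type v} {A : Type u} [Group G] [CommSemigroup A] [IsInverseSemigroup A]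
  (θ : PartialAction G A)

/-- Extensions of the partial `G`-module `(A, θ)` by `G`. -/
abbrev Ext : Type (max u v + 1) := {E : GroupExt A G // E.IsExtensionOf θ}

/-- Equivalence of extensions of `(A, θ)` by `G`. -/
instance extSetoid : Setoid θ.Ext where
  r E E' := E.1.Equivalent E'.1
  iseqv :=
    { refl := fun E => ⟨MulEquiv.refl _, fun _ => rfl, fun _ => rfl⟩
      symm := by
        rintro E E' ⟨μ, hi, hj⟩
        refine ⟨μ.symm, fun a => ?_, fun u => ?_⟩
        · rw [← hi, μ.symm_apply_apply]
        · rw [← hj, μ.apply_symm_apply]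
      trans := by
        rintro E E' E'' ⟨μ, hi, hj⟩ ⟨ν, hi', hj'⟩
        refine ⟨μ.trans ν, fun a => ?_, fun u => ?_⟩
        · rw [MulEquiv.trans_apply, hi, hi']
        · rw [MulEquiv.trans_apply, hj', hj] }

/-- Equivalence classes of extensions of `(A, θ)` by `G`. -/
abbrev ExtClass : Type (max u v + 1) := Quotient θ.extSetoid

/-- The class `[U]` of an extension of `(A, θ)` by `G`. -/
def ExtClass.mk (E : θ.Ext) : θ.ExtClass := Quotient.mk θ.extSetoid E

/-- The extension `E` is the crossed product `A *_{(θ,w)} G` with `i(a) = a δ_1` and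
`j(a δ_x) = x`, up to an isomorphism of the multiplicative structures. -/
def IsCrossedProductExt (w : θ.C₂) (E : GroupExt A G) : Prop :=
  ∃ e : E.U ≃* θ.CrossedProduct w,
    (∀ a, e (E.i a) = CrossedProduct.incl θ w a) ∧ ∀ u, E.j u = (e u).deg

end

end PartialAction

set_option linter.unusedSectionVars false

/-! ### Elementary facts on inverse semigroups -/

section InverseSemigroup

/-! For an arbitrary 2-cochain `w`, the product of `CrossedProduct w` is associative exactly when
`w` is a cocycle (`CrossedProduct.mul_assoc_iff`). The two bracketings of a triple product apply the
two sides of the cocycle identity to the same untwisted product θ_x(θ_x⁻¹(a) θ_y(θ_y⁻¹(b) c)), and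
every element of D_{(x,y,z)} has this form. A 1-cochain `ε` rescales coefficients and identifies the
product twisted by `w' * δ₁ ε` with the one twisted by `w'`. Coboundaries are therefore cocycles,
and w(1,1)⁻¹, restricted to all the D_x, normalizes any cocycle (`PartialAction.exists_isTwisting`).

An equivalence of crossed products fixes A and the degrees, so it acts on each D_x by an A-linear
map preserving group components. Such maps are the invertible multipliers (`Multiplier.unitOfMap`),
and multiplicativity becomes the coboundary equation (`crossedExt_equivalent_iff`). This gives both
well-definedness and injectivity.

A crossed product is refined by the untwisted E(A) *_θ G through aδ_x ↦ aa⁻¹δ_x, with transversal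
eδ_x ↦ eδ_x (`isExtensionOf_crossedExt`). For surjectivity, a transversal ρ factors each p in U as
i(a)ρ(π(p)). The pair (j(p), a) determines p, because j(p) and aa⁻¹ determine π(p). Order
preservation makes p ↦ a linear under left multiplication by A and turns right multiplication by A
into θ. The coefficient of a product is then the untwisted product of the coefficients, acted on by
a multiplier that depends only on the degrees. These multipliers form `w`, and associativity of U
makes `w` a cocycle (`IsOrderPreservingTransversal.exists_isTwisting`). -/

theorem IsInverseSemigroup.of_regular {S : Type u} [Semigroup S]
    (hr : ∀ s : S, ∃ t : S, s * t * s = s)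
    (hc : ∀ e f : S, IsIdempotentElem e → IsIdempotentElem f → e * f = f * e) :
    IsInverseSemigroup S where
  existsUnique_inverse s := by
    obtain ⟨t, ht⟩ := hr s
    refine ⟨t * s * t, ⟨by simp only [← mul_assoc, ht], by
      rw [show t * s * t * s * (t * s * t) = t * (s * t * s) * t * s * t by
        simp only [mul_assoc], ht, show t * s * t * s * t = t * (s * t * s) * t by
        simp only [mul_assoc], ht]⟩, ?_⟩
    -- Two inverses agree by commuting `s * q` with `s * p`, and then `p * s` with `q * s`.
    have key : ∀ p q : S, s * p * s = s ∧ p * s * p = p → s * q * s = s ∧ q * s * q = q →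
        p = q := by
      rintro p q ⟨hp, hp'⟩ ⟨hq, hq'⟩
      have i1 : ∀ r, s * r * s = s → IsIdempotentElem (s * r) := fun r h => by
        unfold IsIdempotentElem; rw [← mul_assoc, h]
      have i2 : ∀ r, s * r * s = s → IsIdempotentElem (r * s) := fun r h => by
        unfold IsIdempotentElem; rw [mul_assoc, ← mul_assoc s, h]
      calc p = p * ((s * q) * (s * p)) := by
            rw [show p * ((s * q) * (s * p)) = p * (s * q * s) * p by simp only [mul_assoc],
              hq, hp']
        _ = p * ((s * p) * (s * q)) := by rw [hc _ _ (i1 q hq) (i1 p hp)]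
        _ = p * s * q := by rw [← mul_assoc, ← mul_assoc, ← mul_assoc, hp', mul_assoc]
        _ = p * s * (q * s * q) := by rw [hq']
        _ = (p * s) * (q * s) * q := by simp only [mul_assoc]
        _ = (q * s) * (p * s) * q := by rw [hc _ _ (i2 p hp) (i2 q hq)]
        _ = q * (s * p * s) * q := by simp only [mul_assoc]
        _ = q := by rw [hp, hq']
    intro q hq
    refine key _ _ hq ⟨by simp only [← mul_assoc, ht], ?_⟩
    rw [show t * s * t * s * (t * s * t) = t * (s * t * s) * t * s * t by
        simp only [mul_assoc], ht, show t * s * t * s * t = t * (s * t * s) * t by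
        simp only [mul_assoc], ht]

variable {S : Type u} [Semigroup S] [IsInverseSemigroup S]

theorem eq_sinv {s t : S} (h₁ : s * t * s = s) (h₂ : t * s * t = t) : t = sinv s :=
  (IsInverseSemigroup.existsUnique_inverse s).unique ⟨h₁, h₂⟩ ⟨mul_sinv_mul s, sinv_mul_sinv s⟩

@[simp] theorem sinv_sinv (s : S) : sinv (sinv s) = s :=
  (eq_sinv (sinv_mul_sinv s) (mul_sinv_mul s)).symm

theorem IsIdempotentElem.sinv_eq {e : S} (h : IsIdempotentElem e) : sinv e = e :=
  (eq_sinv (by rw [h.eq, h.eq]) (by rw [h.eq, h.eq])).symm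

theorem isIdempotentElem_mul_sinv (s : S) : IsIdempotentElem (s * sinv s) := by
  unfold IsIdempotentElem; rw [← mul_assoc, mul_sinv_mul]

theorem isIdempotentElem_sinv_mul (s : S) : IsIdempotentElem (sinv s * s) := by
  unfold IsIdempotentElem; rw [← mul_assoc, sinv_mul_sinv]

/-- With `x` the inverse of `e * f`, also `f * x * e` is an inverse, so the two coincide. This form
makes `x` idempotent, hence its own inverse, which is `e * f`. -/
theorem IsIdempotentElem.mul_of_inverse {e f : S} (he : IsIdempotentElem e)
    (hf : IsIdempotentElem f) : IsIdempotentElem (e * f) := by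
  have h1 := mul_sinv_mul (e * f)
  have h2 := sinv_mul_sinv (e * f)
  set x := sinv (e * f) with hx
  have hfx : f * x * e = x := by
    refine eq_sinv ?_ ?_
    · rw [show e * f * (f * x * e) * (e * f) = e * (f * f) * x * (e * e) * f by
        simp only [mul_assoc], he.eq, hf.eq, mul_assoc _ e f, h1]
    · rw [show f * x * e * (e * f) * (f * x * e) = f * (x * ((e * e) * (f * f)) * x) * e by
        simp only [mul_assoc], he.eq, hf.eq, h2]
  have hxi : IsIdempotentElem x := by
    unfold IsIdempotentElem
    conv_lhs => rw [← hfx]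
    rw [show f * x * e * (f * x * e) = f * (x * (e * f) * x) * e by simp only [mul_assoc], h2, hfx]
  have : e * f = x := by rw [← sinv_sinv (e * f), ← hx, hxi.sinv_eq]
  rw [this]; exact hxi

/-- Both `f * e` and the idempotent `e * f` itself are inverses of `e * f`. -/
theorem IsIdempotentElem.comm_of_inverse {e f : S} (he : IsIdempotentElem e)
    (hf : IsIdempotentElem f) : e * f = f * e := by
  have h1 := he.mul_of_inverse hf
  have h2 := hf.mul_of_inverse he
  rw [← h1.sinv_eq]
  refine (eq_sinv ?_ ?_).symm
  · rw [show e * f * (f * e) * (e * f) = e * (f * f) * (e * e) * f by simp only [mul_assoc],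
      he.eq, hf.eq, mul_assoc, h1.eq]
  · rw [show f * e * (e * f) * (f * e) = f * (e * e) * (f * f) * e by simp only [mul_assoc],
      he.eq, hf.eq, mul_assoc, h2.eq]

theorem sinv_mul_rev (s t : S) : sinv (s * t) = sinv t * sinv s := by
  have h := (isIdempotentElem_sinv_mul s).comm_of_inverse (isIdempotentElem_mul_sinv t)
  refine (eq_sinv ?_ ?_).symm
  · rw [show s * t * (sinv t * sinv s) * (s * t) = s * ((t * sinv t) * (sinv s * s)) * t by
      simp only [mul_assoc], ← h, show s * ((sinv s * s) * (t * sinv t)) * t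
        = (s * sinv s * s) * (t * sinv t * t) by simp only [mul_assoc], mul_sinv_mul, mul_sinv_mul]
  · rw [show sinv t * sinv s * (s * t) * (sinv t * sinv s)
        = sinv t * ((sinv s * s) * (t * sinv t)) * sinv s by simp only [mul_assoc], h,
      show sinv t * ((t * sinv t) * (sinv s * s)) * sinv s
        = (sinv t * t * sinv t) * (sinv s * s * sinv s) by simp only [mul_assoc],
      sinv_mul_sinv, sinv_mul_sinv]

/-- Two idempotents that both fix `s` on the left and lie in `s * S` absorb each other, so they are
equal once they commute. Any quasi-inverse thus suffices to compute `s * sinv s`. -/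
theorem mul_eq_mul_sinv {s t : S} (h : s * t * s = s) : s * t = s * sinv s := by
  have h1 : IsIdempotentElem (s * t) := by unfold IsIdempotentElem; rw [← mul_assoc, h]
  have h2 := h1.comm_of_inverse (isIdempotentElem_mul_sinv s)
  rwa [← mul_assoc, h, ← mul_assoc, mul_sinv_mul, eq_comm] at h2

theorem mul_eq_sinv_mul {s t : S} (h : s * t * s = s) : t * s = sinv s * s := by
  have h1 : IsIdempotentElem (t * s) := by
    unfold IsIdempotentElem; rw [mul_assoc, ← mul_assoc s, h]
  have h2 := h1.comm_of_inverse (isIdempotentElem_sinv_mul s)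
  rwa [mul_assoc, ← mul_assoc s, mul_sinv_mul, mul_assoc, ← mul_assoc s, h] at h2

theorem map_sinv {T : Type v} [Semigroup T] [IsInverseSemigroup T] (f : S →ₙ* T) (s : S) :
    f (sinv s) = sinv (f s) :=
  eq_sinv (by rw [← map_mul, ← map_mul, mul_sinv_mul])
    (by rw [← map_mul, ← map_mul, sinv_mul_sinv])

theorem IsIdempotentElem.map_mulHom {M : Type u} {N : Type v} [Mul M] [Mul N] {e : M}
    (h : IsIdempotentElem e) (f : M →ₙ* N) : IsIdempotentElem (f e) := by
  unfold IsIdempotentElem; rw [← map_mul, h.eq]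

theorem map_idempotent_eq_one {M : Type u} {G : Type v} [Mul M] [Group G] {e : M}
    (h : IsIdempotentElem e) (f : M →ₙ* G) : f e = 1 := by
  have := (h.map_mulHom f).eq
  simpa using this

theorem map_sinv_eq_inv {G : Type v} [Group G] (f : S →ₙ* G) (s : S) : f (sinv s) = (f s)⁻¹ := by
  have := map_idempotent_eq_one (isIdempotentElem_mul_sinv s) f
  rw [map_mul] at this
  exact (inv_eq_of_mul_eq_one_right this).symm

end InverseSemigroup

/-! ### Group components of a commutative inverse semigroup. -/

section Commutative

variable {A : Type u} [CommSemigroup A] [IsInverseSemigroup A]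

/-- The idempotent `a a⁻¹` of the group component of `a`. -/
noncomputable def supp (a : A) : A := a * sinv a

theorem isIdempotentElem_supp (a : A) : IsIdempotentElem (supp a) := isIdempotentElem_mul_sinv a

@[simp] theorem supp_mul_supp (a : A) : supp a * supp a = supp a := isIdempotentElem_supp a

@[simp] theorem supp_mul_self (a : A) : supp a * a = a := mul_sinv_mul a

@[simp] theorem mul_supp_self (a : A) : a * supp a = a := by rw [mul_comm, supp_mul_self]

theorem IsIdempotentElem.supp_eq {e : A} (h : IsIdempotentElem e) : supp e = e := by
  unfold supp; rw [h.sinv_eq, h.eq]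

@[simp] theorem supp_supp (a : A) : supp (supp a) = supp a := (isIdempotentElem_supp a).supp_eq

theorem supp_mul (a b : A) : supp (a * b) = supp a * supp b := by
  unfold supp; rw [sinv_mul_rev, mul_comm (sinv b), mul_mul_mul_comm]

@[simp] theorem supp_sinv (a : A) : supp (sinv a) = supp a := by
  unfold supp; rw [sinv_sinv, mul_comm]

theorem IsSemigroupIdeal.supp_mem {I : Subsemigroup A} (hI : IsSemigroupIdeal I) {a : A}
    (h : a ∈ I) : supp a ∈ I := hI.mul_mem_right _ _ h

/-- Ideals are unions of group components, since `a` is a multiple of its support. -/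
theorem IsSemigroupIdeal.mem_of_supp_mem {I : Subsemigroup A} (hI : IsSemigroupIdeal I) {a : A}
    (h : supp a ∈ I) : a ∈ I := by
  rw [← supp_mul_self a]; exact hI.mul_mem_right _ _ h

theorem IsSemigroupIdeal.sinv_mem {I : Subsemigroup A} (hI : IsSemigroupIdeal I) {a : A}
    (h : a ∈ I) : sinv a ∈ I := hI.mem_of_supp_mem (by rw [supp_sinv]; exact hI.supp_mem h)

end Commutative

/-! ### Multipliers and partial actions as totally defined maps -/

theorem mul_inv_mul_mul_inv_eq_one_iff {C : Type u} [CommGroup C] (p q r s : C) :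
    p * q⁻¹ * r * s⁻¹ = 1 ↔ p * r = q * s := by
  rw [mul_inv_eq_one, mul_right_comm, mul_inv_eq_iff_eq_mul, mul_comm s q]

theorem eq_mul_mul_inv_mul_iff {C : Type u} [CommGroup C] (w w' p q r : C) :
    w = w' * (p * q⁻¹ * r) ↔ q * w = w' * (p * r) := by
  rw [mul_right_comm p, ← mul_assoc, eq_mul_inv_iff_mul_eq, mul_comm q]

namespace Multiplier

section
variable {A : Type u} [CommSemigroup A] {I J : Subsemigroup A}

open Classical in
/-- The map `a ↦ w a`, extended by the identity outside of `I`. -/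
noncomputable def app (w : Multiplier I) (a : A) : A :=
  if h : a ∈ I then w.left ⟨a, h⟩ else a

theorem app_of_mem (w : Multiplier I) {a : A} (h : a ∈ I) : w.app a = w.left ⟨a, h⟩ := dif_pos h

theorem app_mem (w : Multiplier I) {a : A} (h : a ∈ I) : w.app a ∈ I := by
  rw [app_of_mem w h]; exact (w.left ⟨a, h⟩).2

theorem app_mul_of_mem (w : Multiplier I) {a b : A} (ha : a ∈ I) (hb : b ∈ I) :
    w.app (a * b) = w.app a * b := by
  rw [app_of_mem w (I.mul_mem ha hb), app_of_mem w ha]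
  exact congrArg Subtype.val (w.left_mul ⟨a, ha⟩ ⟨b, hb⟩)

@[simp] theorem app_one (a : A) : (1 : Multiplier I).app a = a := by
  unfold app; split_ifs <;> rfl

theorem app_mul (w w' : Multiplier I) {a : A} (h : a ∈ I) :
    (w * w').app a = w.app (w'.app a) := by
  rw [app_of_mem w (app_mem w' h), app_of_mem _ h]
  simp only [app_of_mem w' h]
  rfl

variable [IsInverseSemigroup A]

theorem right_eq_app (hI : IsSemigroupIdeal I) (w : Multiplier I) (a : I) :
    (w.right a : A) = w.app a := by
  have := hI.isRegularSemigroup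
  rw [app_of_mem w a.2, left_eq_right]

/-- The axiom covers only factors in `I`, but an arbitrary `b` can be replaced by `supp a * b`,
which lies in `I`. -/
theorem app_mul_right (hI : IsSemigroupIdeal I) (w : Multiplier I) {a : A} (ha : a ∈ I) (b : A) :
    w.app (a * b) = w.app a * b := by
  have hs := hI.supp_mem ha
  calc w.app (a * b) = w.app (a * (supp a * b)) := by rw [← mul_assoc, mul_supp_self]
    _ = w.app (a * supp a) * b := by
      rw [app_mul_of_mem w ha (hI.mul_mem_right _ _ hs), app_mul_of_mem w ha hs, mul_assoc]
    _ = w.app a * b := by rw [mul_supp_self]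

theorem app_mul_left (hI : IsSemigroupIdeal I) (w : Multiplier I) {a : A} (ha : a ∈ I) (b : A) :
    w.app (b * a) = b * w.app a := by
  rw [mul_comm, app_mul_right hI w ha, mul_comm]

theorem app_ext (hI : IsSemigroupIdeal I) {w w' : Multiplier I}
    (h : ∀ a ∈ I, w.app a = w'.app a) : w = w' := by
  have hr := hI.isRegularSemigroup
  have hl : ∀ a, w.left a = w'.left a := fun a => Subtype.ext (by
    rw [← app_of_mem w a.2, ← app_of_mem w' a.2, h a a.2])
  exact Multiplier.ext (funext hl) (funext fun a => by rw [← left_eq_right, ← left_eq_right, hl])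

theorem units_ext (hI : IsSemigroupIdeal I) {w w' : (Multiplier I)ˣ}
    (h : ∀ a ∈ I, w.val.app a = w'.val.app a) : w = w' := Units.ext (app_ext hI h)

theorem app_app_inv (w : (Multiplier I)ˣ) {a : A} (h : a ∈ I) :
    w.val.app (w⁻¹.val.app a) = a := by
  rw [← app_mul _ _ h, Units.mul_inv, app_one]

theorem app_inv_app (w : (Multiplier I)ˣ) {a : A} (h : a ∈ I) :
    w⁻¹.val.app (w.val.app a) = a := by
  rw [← app_mul _ _ h, Units.inv_mul, app_one]

theorem app_mul_supp (hI : IsSemigroupIdeal I) (w : Multiplier I) {a : A} (h : a ∈ I) :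
    w.app a * supp a = w.app a := by
  rw [← app_mul_right hI w h, mul_supp_self]

/-- Linearity gives `supp (w a) ≤ supp a`; the same for `w⁻¹` gives the reverse inequality. -/
theorem supp_app (hI : IsSemigroupIdeal I) (w : (Multiplier I)ˣ) {a : A} (h : a ∈ I) :
    supp (w.val.app a) = supp a := by
  have h1 := congrArg supp (app_mul_supp hI w.val h)
  have h2 := congrArg supp (app_mul_supp hI w⁻¹.val (app_mem w.val h))
  rw [app_inv_app w h] at h2
  rw [supp_mul, supp_supp] at h1 h2
  rw [← h1, mul_comm, h2]

/-- On `a`, the multiplier `w'` is multiplication by the element `w' (supp a)`, and `w` is linear.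
The two ideals may differ. -/
theorem app_comm (hI : IsSemigroupIdeal I) (hJ : IsSemigroupIdeal J) (w : Multiplier I)
    (w' : Multiplier J) {a : A} (ha : a ∈ I) (ha' : a ∈ J) :
    w.app (w'.app a) = w'.app (w.app a) := by
  have hs := hJ.supp_mem ha'
  have h1 : w'.app a = a * w'.app (supp a) := by
    rw [← app_mul_left hJ w' hs, mul_supp_self]
  rw [h1, app_mul_right hI w ha, ← app_mul_left hJ w' hs, app_mul_supp hI w ha]

theorem app_restrict (hJI : J ≤ I) (hJ : IsSemigroupIdeal J) (w : Multiplier I) {a : A}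
    (h : a ∈ J) : (restrict hJI hJ w).app a = w.app a := by
  rw [app_of_mem _ h, app_of_mem _ (hJI h)]
  rfl

/-- The invertible multiplier of `I` given by a map `F` preserving group components. -/
noncomputable def unitOfMap (hI : IsSemigroupIdeal I) (F : A → A)
    (hm : ∀ a b, a ∈ I → F (a * b) = F a * b) (hs : ∀ a, a ∈ I → supp (F a) = supp a) :
    (Multiplier I)ˣ := by
  have hF : ∀ a, a ∈ I → F a ∈ I := fun a ha =>
    hI.mem_of_supp_mem (by rw [hs a ha]; exact hI.supp_mem ha)
  have hr := hI.isRegularSemigroup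
  -- `F` multiplies `a` by `F (supp a)`, an element of the group with identity `supp a`; the inverse
  -- map multiplies by the group inverse.
  let F' : A → A := fun a => a * sinv (F (supp a))
  have hF' : ∀ a, a ∈ I → F' a ∈ I := fun a ha => hI.mul_mem_right _ _ ha
  have hm' : ∀ a b, a ∈ I → F' (a * b) = F' a * b := fun a b ha => by
    change a * b * sinv (F (supp (a * b))) = a * sinv (F (supp a)) * b
    have : sinv (supp b) = supp b := (isIdempotentElem_supp b).sinv_eq
    rw [supp_mul, hm _ _ (hI.supp_mem ha), sinv_mul_rev, this, ← mul_assoc, mul_assoc a b,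
      mul_supp_self, mul_assoc a, mul_assoc a, mul_comm b]
  have h1 : ∀ a, a ∈ I → F (F' a) = a := fun a ha => by
    have h2 : F a = a * F (supp a) := by
      rw [mul_comm, ← hm _ _ (hI.supp_mem ha), supp_mul_self]
    change F (a * sinv (F (supp a))) = a
    rw [hm _ _ ha, h2, mul_assoc]
    change a * supp _ = a
    rw [hs _ (hI.supp_mem ha), supp_supp, mul_supp_self]
  have h2 : ∀ a, a ∈ I → F' (F a) = a := fun a ha => by
    have h2 : F a = a * F (supp a) := by
      rw [mul_comm, ← hm _ _ (hI.supp_mem ha), supp_mul_self]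
    change F a * sinv (F (supp (F a))) = a
    rw [hs a ha, h2, mul_assoc]
    change a * supp _ = a
    rw [hs _ (hI.supp_mem ha), supp_supp, mul_supp_self]
  let mk (F : A → A) (hF : ∀ a, a ∈ I → F a ∈ I) (hm : ∀ a b, a ∈ I → F (a * b) = F a * b) :
      Multiplier I :=
    { left := fun a => ⟨F a, hF a a.2⟩
      right := fun a => ⟨F a, hF a a.2⟩
      left_mul := fun s t => Subtype.ext (hm s t s.2)
      right_mul := fun s t => Subtype.ext (by
        change F (s * t) = s * F t
        rw [mul_comm, hm _ _ t.2, mul_comm])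
      linked := fun s t => Subtype.ext (by
        change s * F t = F s * t
        rw [← hm _ _ s.2, mul_comm (s : A), ← hm _ _ t.2, mul_comm (s : A)]) }
  exact
    { val := mk F hF hm
      inv := mk F' hF' hm'
      val_inv := Multiplier.ext (funext fun a => Subtype.ext (h1 a a.2))
        (funext fun a => Subtype.ext (h2 a a.2))
      inv_val := Multiplier.ext (funext fun a => Subtype.ext (h2 a a.2))
        (funext fun a => Subtype.ext (h1 a a.2)) }

theorem app_unitOfMap (hI : IsSemigroupIdeal I) (F : A → A)
    (hm : ∀ a b, a ∈ I → F (a * b) = F a * b) (hs : ∀ a, a ∈ I → supp (F a) = supp a)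
    {a : A} (h : a ∈ I) : (unitOfMap hI F hm hs).val.app a = F a := by
  rw [app_of_mem _ h]; rfl

end

end Multiplier

/-! ### Partial actions and the untwisted product. -/

namespace PartialAction

section
variable {G : Type v} {A : Type u} [Group G] [CommSemigroup A]
  (θ : PartialAction G A)

open Classical in
/-- The isomorphism `θ_x`, extended by the identity outside of `D_{x⁻¹}`. -/
noncomputable def map (x : G) (a : A) : A :=
  if h : a ∈ θ.D x⁻¹ then θ.θ x ⟨a, h⟩ else a

variable {x y z : G} {a b c : A}

theorem map_of_mem (h : a ∈ θ.D x⁻¹) : θ.map x a = θ.θ x ⟨a, h⟩ := dif_pos h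

theorem mem_D_one (a : A) : a ∈ θ.D 1 := by rw [θ.D_one]; trivial

theorem map_mem (h : a ∈ θ.D x⁻¹) : θ.map x a ∈ θ.D x := by
  rw [θ.map_of_mem h]; exact (θ.θ x ⟨a, h⟩).2

theorem map_inv_mem (h : a ∈ θ.D x) : θ.map x⁻¹ a ∈ θ.D x⁻¹ :=
  θ.map_mem (by rwa [inv_inv])

theorem map_mem_iff (h : a ∈ θ.D x⁻¹) : θ.map x a ∈ θ.D (x * y) ↔ a ∈ θ.D y := by
  rw [θ.map_of_mem h]; exact (θ.mem_iff x y ⟨a, h⟩).symm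

theorem map_inv_mem_iff (h : a ∈ θ.D x) : θ.map x⁻¹ a ∈ θ.D y ↔ a ∈ θ.D (x * y) := by
  rw [← θ.map_mem_iff (x := x⁻¹) (y := x * y) (by rwa [inv_inv]), inv_mul_cancel_left]

theorem map_mul (ha : a ∈ θ.D x⁻¹) (hb : b ∈ θ.D x⁻¹) :
    θ.map x (a * b) = θ.map x a * θ.map x b := by
  rw [θ.map_of_mem ha, θ.map_of_mem hb, θ.map_of_mem (mul_mem ha hb)]
  exact congrArg Subtype.val (_root_.map_mul (θ.θ x) ⟨a, ha⟩ ⟨b, hb⟩)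

theorem map_inv_mul (ha : a ∈ θ.D x) (hb : b ∈ θ.D x) :
    θ.map x⁻¹ (a * b) = θ.map x⁻¹ a * θ.map x⁻¹ b :=
  θ.map_mul (by rwa [inv_inv]) (by rwa [inv_inv])

@[simp] theorem map_one (a : A) : θ.map 1 a = a := by
  rw [θ.map_of_mem (by rw [inv_one]; exact θ.mem_D_one a)]; exact θ.θ_one _

theorem map_map (h : a ∈ θ.D y⁻¹) (h' : a ∈ θ.D (x * y)⁻¹) :
    θ.map x (θ.map y a) = θ.map (x * y) a := by
  have h₃ : θ.map y a ∈ θ.D x⁻¹ := by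
    have := (θ.map_mem_iff (y := (x * y)⁻¹) h).2 h'
    rwa [mul_inv_rev, mul_inv_cancel_left] at this
  rw [θ.map_of_mem h₃, θ.map_of_mem h', ← θ.θ_comp x y a h h' (by
    rw [← θ.map_of_mem h]; exact h₃)]
  congr 2
  exact Subtype.ext (θ.map_of_mem h)

theorem map_map_inv (h : a ∈ θ.D x) : θ.map x (θ.map x⁻¹ a) = a := by
  rw [θ.map_map (by rwa [inv_inv]) (by rw [mul_inv_cancel, inv_one]; exact θ.mem_D_one a),
    mul_inv_cancel, map_one]

theorem map_inv_map (h : a ∈ θ.D x⁻¹) : θ.map x⁻¹ (θ.map x a) = a := by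
  rw [θ.map_map h (by rw [inv_mul_cancel, inv_one]; exact θ.mem_D_one a),
    inv_mul_cancel, map_one]

theorem map_map_of_mem (h : a ∈ θ.D x⁻¹) (h' : a ∈ θ.D y) :
    θ.map y⁻¹ a = θ.map (x * y)⁻¹ (θ.map x a) := by
  have := θ.map_map (x := (x * y)⁻¹) (y := x) (a := a) h (by simpa using h')
  rw [this, mul_inv_rev, inv_mul_cancel_right]

theorem symm_apply_eq_map (a : θ.D x) : ((θ.θ x).symm a : A) = θ.map x⁻¹ a := by
  have : (θ.θ x).symm a = ⟨θ.map x⁻¹ a, θ.map_inv_mem a.2⟩ := by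
    rw [MulEquiv.symm_apply_eq]
    apply Subtype.ext
    rw [← θ.map_of_mem, θ.map_map_inv a.2]
  rw [this]

theorem D₂_le_left (x y : G) : θ.D₂ x y ≤ θ.D x := inf_le_left

theorem D₂_le_right (x y : G) : θ.D₂ x y ≤ θ.D (x * y) := inf_le_right

variable [IsInverseSemigroup A]

theorem map_sinv (h : a ∈ θ.D x⁻¹) : θ.map x (sinv a) = sinv (θ.map x a) := by
  have h' := (θ.isIdeal _).sinv_mem h
  refine eq_sinv ?_ ?_
  · rw [← θ.map_mul h h', ← θ.map_mul (mul_mem h h') h, mul_sinv_mul]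
  · rw [← θ.map_mul h' h, ← θ.map_mul (mul_mem h' h) h', sinv_mul_sinv]

theorem map_supp (h : a ∈ θ.D x⁻¹) : θ.map x (supp a) = supp (θ.map x a) := by
  unfold supp; rw [θ.map_mul h ((θ.isIdeal _).sinv_mem h), θ.map_sinv h]

theorem map_inv_supp (h : a ∈ θ.D x) : θ.map x⁻¹ (supp a) = supp (θ.map x⁻¹ a) :=
  θ.map_supp (by rwa [inv_inv])

/-- The product `θ_x(θ_x⁻¹(a) b)`. -/
noncomputable def tmul (x : G) (a b : A) : A := θ.map x (θ.map x⁻¹ a * b)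

theorem map_inv_mul_mem (ha : a ∈ θ.D x) (b : A) : θ.map x⁻¹ a * b ∈ θ.D x⁻¹ :=
  (θ.isIdeal _).mul_mem_right _ _ (θ.map_inv_mem ha)

theorem tmul_mem (ha : a ∈ θ.D x) (b : A) : θ.tmul x a b ∈ θ.D x :=
  θ.map_mem (θ.map_inv_mul_mem ha b)

theorem tmul_mem_mul (ha : a ∈ θ.D x) (hb : b ∈ θ.D y) : θ.tmul x a b ∈ θ.D (x * y) :=
  (θ.map_mem_iff (θ.map_inv_mul_mem ha b)).2 ((θ.isIdeal _).mul_mem_left _ _ hb)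

theorem tmul_mem₂ (ha : a ∈ θ.D x) (hb : b ∈ θ.D y) : θ.tmul x a b ∈ θ.D₂ x y :=
  ⟨θ.tmul_mem ha b, θ.tmul_mem_mul ha hb⟩

theorem coe_twistedMul (a : θ.D x) (b : θ.D y) :
    (θ.twistedMul a b : A) = θ.tmul x a b := by
  unfold tmul
  rw [θ.map_of_mem (θ.map_inv_mul_mem a.2 b)]
  simp only [← symm_apply_eq_map]
  rfl

/-- Although `b` need not lie in D_x, `b * supp a` does, so θ_x undoes θ_x⁻¹ on it; the factor `supp
a` is then absorbed. -/
theorem mul_tmul (ha : a ∈ θ.D x) (b c : A) :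
    θ.tmul x (b * a) c = b * θ.tmul x a c := by
  have h1 : b * a = (b * supp a) * a := by rw [mul_assoc, supp_mul_self]
  have h2 : b * supp a ∈ θ.D x := (θ.isIdeal _).mul_mem_left _ _ ((θ.isIdeal _).supp_mem ha)
  have h3 : supp a * θ.tmul x a c = θ.tmul x a c := by
    unfold tmul
    conv_lhs => enter [1]; rw [← θ.map_map_inv ((θ.isIdeal _).supp_mem ha)]
    rw [← θ.map_mul (θ.map_inv_mem ((θ.isIdeal _).supp_mem ha)) (θ.map_inv_mul_mem ha c),
      ← mul_assoc, ← θ.map_inv_mul ((θ.isIdeal _).supp_mem ha) ha, supp_mul_self]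
  rw [h1]
  conv_lhs => unfold tmul
  rw [θ.map_inv_mul h2 ha, mul_assoc, θ.map_mul (θ.map_inv_mem h2) (θ.map_inv_mul_mem ha c),
    θ.map_map_inv h2, mul_assoc]
  exact congrArg (b * ·) h3

/-- On `a`, the multiplier is multiplication by an element of A, and `tmul` is linear in its left
argument. -/
theorem app_tmul {I : Subsemigroup A} (hI : IsSemigroupIdeal I) (hx : I ≤ θ.D x)
    (w : Multiplier I) (ha : a ∈ I) (c : A) :
    θ.tmul x (w.app a) c = w.app (θ.tmul x a c) := by
  have hs := hI.supp_mem ha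
  have h2 : θ.tmul x a c = a * θ.tmul x (supp a) c := by
    rw [← θ.mul_tmul (hx hs), mul_supp_self]
  rw [← Multiplier.app_mul_supp hI w ha, θ.mul_tmul (hx hs), h2, Multiplier.app_mul_right hI w ha]

/-- A multiplier in the right argument comes out conjugated by θ_x, which is the first term of δ¹
and δ². -/
theorem tmul_app {I : Subsemigroup A} (hI : IsSemigroupIdeal I) (w : Multiplier I)
    (ha : a ∈ θ.D x) (hb : b ∈ I) :
    θ.tmul x a (w.app b) = θ.map x (w.app (θ.map x⁻¹ (θ.tmul x a b))) := by
  unfold tmul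
  rw [θ.map_inv_map (θ.map_inv_mul_mem ha b), Multiplier.app_mul_left hI w hb]

theorem supp_tmul (ha : a ∈ θ.D x) (b : A) :
    supp (θ.tmul x a b) = θ.tmul x (supp a) (supp b) := by
  unfold tmul
  rw [← θ.map_supp (θ.map_inv_mul_mem ha b), supp_mul, θ.map_inv_supp ha]

theorem tmul_map (ha : a ∈ θ.D x) (hb : b ∈ θ.D x) : θ.tmul x a (θ.map x⁻¹ b) = a * b := by
  unfold tmul; rw [← θ.map_inv_mul ha hb, θ.map_map_inv (mul_mem ha hb)]

/-- Applying θ_{xy}⁻¹ to θ_x(θ_x⁻¹(a)b) gives θ_y⁻¹(θ_x⁻¹(a)b); left linearity of `tmul y` then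
moves θ_x⁻¹(a) outside. -/
theorem tmul_tmul (ha : a ∈ θ.D x) (hb : b ∈ θ.D y) (c : A) :
    θ.tmul (x * y) (θ.tmul x a b) c = θ.tmul x a (θ.tmul y b c) := by
  set a' := θ.map x⁻¹ a with ha'
  have h1 : a' ∈ θ.D x⁻¹ := θ.map_inv_mem ha
  have h2 : a' * b ∈ θ.D x⁻¹ := θ.map_inv_mul_mem ha b
  have h3 : a' * b ∈ θ.D y := (θ.isIdeal _).mul_mem_left _ _ hb
  have h4 : θ.tmul y (a' * b) c = a' * θ.tmul y b c := θ.mul_tmul hb a' c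
  have h5 : θ.map (x * y)⁻¹ (θ.tmul x a b) = θ.map y⁻¹ (a' * b) := (θ.map_map_of_mem h2 h3).symm
  have h6 : θ.map y⁻¹ (a' * b) * c ∈ θ.D y⁻¹ := θ.map_inv_mul_mem h3 c
  unfold tmul at h4 ⊢
  change θ.map (x * y) (θ.map (x * y)⁻¹ (θ.tmul x a b) * c) = _
  rw [h5, ← ha', ← h4, θ.map_map h6]
  refine (θ.isIdeal _).mul_mem_right _ _ ?_
  rw [mul_inv_rev]
  refine (θ.map_mem_iff (by rwa [inv_inv])).2 h2

theorem app_act₁ (w : (Multiplier (θ.D y))ˣ) (h : a ∈ θ.D₂ x y) :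
    (θ.act₁ x y w).val.app a = θ.map x (w.val.app (θ.map x⁻¹ a)) := by
  have h1 : θ.map x⁻¹ a ∈ θ.D y := (θ.map_inv_mem_iff h.1).2 h.2
  have h2 := θ.map_inv_mem h.1
  -- Inserting the support of the argument shows that `w` preserves every ideal, not only those
  -- inside D_y.
  have h3 : w.val.app (θ.map x⁻¹ a) ∈ θ.D x⁻¹ := by
    rw [← mul_supp_self (θ.map x⁻¹ a), Multiplier.app_mul_right (θ.isIdeal y) _ h1]
    exact (θ.isIdeal _).mul_mem_left _ _ ((θ.isIdeal _).supp_mem h2)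
  rw [Multiplier.app_of_mem _ h, θ.map_of_mem h3]
  have h4 : w.val.app (θ.map x⁻¹ a) = w.val.left ⟨(θ.θ x).symm ⟨a, h.1⟩, by
      rw [symm_apply_eq_map]; exact h1⟩ := by
    have e : (⟨θ.map x⁻¹ a, h1⟩ : θ.D y) = ⟨(θ.θ x).symm ⟨a, h.1⟩, by
      rw [symm_apply_eq_map]; exact h1⟩ := Subtype.ext (θ.symm_apply_eq_map ⟨a, h.1⟩).symm
    rw [Multiplier.app_of_mem _ h1, e]
  simp only [h4]
  rfl

theorem app_act₂ (w : (Multiplier (θ.D₂ y z))ˣ) (h : a ∈ θ.D₃ x y z) :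
    (θ.act₂ x y z w).val.app a = θ.map x (w.val.app (θ.map x⁻¹ a)) := by
  have h1 : θ.map x⁻¹ a ∈ θ.D₂ y z := ⟨(θ.map_inv_mem_iff h.1).2 h.2.1,
    (θ.map_inv_mem_iff h.1).2 (by rw [← mul_assoc]; exact h.2.2)⟩
  have h2 := θ.map_inv_mem h.1
  have h3 : w.val.app (θ.map x⁻¹ a) ∈ θ.D x⁻¹ := by
    rw [← mul_supp_self (θ.map x⁻¹ a), Multiplier.app_mul_right (θ.isIdeal₂ y z) _ h1]
    exact (θ.isIdeal _).mul_mem_left _ _ ((θ.isIdeal _).supp_mem h2)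
  rw [Multiplier.app_of_mem _ h, θ.map_of_mem h3]
  have h4 : w.val.app (θ.map x⁻¹ a) = w.val.left ⟨(θ.θ x).symm ⟨a, h.1⟩, by
      rw [symm_apply_eq_map]; exact h1⟩ := by
    have e : (⟨θ.map x⁻¹ a, h1⟩ : θ.D₂ y z) = ⟨(θ.θ x).symm ⟨a, h.1⟩, by
      rw [symm_apply_eq_map]; exact h1⟩ := Subtype.ext (θ.symm_apply_eq_map ⟨a, h.1⟩).symm
    rw [Multiplier.app_of_mem _ h1, e]
  simp only [h4]
  rfl

theorem map_inv_mem₂ (h : a ∈ θ.D₃ x y z) : θ.map x⁻¹ a ∈ θ.D₂ y z :=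
  ⟨(θ.map_inv_mem_iff h.1).2 h.2.1, (θ.map_inv_mem_iff h.1).2 (by rw [← mul_assoc]; exact h.2.2)⟩

theorem app_res {I J : Subsemigroup A} (hJI : J ≤ I) (hJ : IsSemigroupIdeal J)
    (w : (Multiplier I)ˣ) (h : a ∈ J) : (res hJI hJ w).val.app a = w.val.app a :=
  Multiplier.app_restrict hJI hJ w.val h

/-- The cocycle identity, written with values. -/
theorem mem_Z₂_iff (w : θ.C₂) : w ∈ θ.Z₂ ↔ ∀ x y z, ∀ a ∈ θ.D₃ x y z,
    θ.map x ((w y z).val.app (θ.map x⁻¹ ((w x (y * z)).val.app a))) =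
      (w (x * y) z).val.app ((w x y).val.app a) := by
  have key : ∀ x y z, θ.δ₂ w x y z = 1 ↔ ∀ a ∈ θ.D₃ x y z,
      θ.map x ((w y z).val.app (θ.map x⁻¹ ((w x (y * z)).val.app a))) =
        (w (x * y) z).val.app ((w x y).val.app a) := by
    intro x y z
    set p := θ.act₂ x y z (w y z) with hp
    set q := res (θ.D₃_le₁ x y z) (θ.isIdeal₃ x y z) (w (x * y) z) with hq
    set r := res (θ.D₃_le₂ x y z) (θ.isIdeal₃ x y z) (w x (y * z)) with hr
    set s := res (θ.D₃_le₃ x y z) (θ.isIdeal₃ x y z) (w x y) with hs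
    have h1 : θ.δ₂ w x y z = 1 ↔ p * r = q * s := by
      change p * q⁻¹ * r * s⁻¹ = 1 ↔ _
      exact mul_inv_mul_mul_inv_eq_one_iff (C := (Multiplier (θ.D₃ x y z))ˣ) p q r s
    have h2 : ∀ a ∈ θ.D₃ x y z, (p * r).val.app a =
        θ.map x ((w y z).val.app (θ.map x⁻¹ ((w x (y * z)).val.app a))) := fun a ha => by
      have : (w x (y * z)).val.app a ∈ θ.D₃ x y z := by
        rw [← app_res (θ.D₃_le₂ x y z) (θ.isIdeal₃ x y z) _ ha]; exact Multiplier.app_mem _ ha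
      rw [Units.val_mul, Multiplier.app_mul _ _ ha, hr, app_res _ _ _ ha, hp, θ.app_act₂ _ this]
    have h3 : ∀ a ∈ θ.D₃ x y z, (q * s).val.app a =
        (w (x * y) z).val.app ((w x y).val.app a) := fun a ha => by
      have : (w x y).val.app a ∈ θ.D₃ x y z := by
        rw [← app_res (θ.D₃_le₃ x y z) (θ.isIdeal₃ x y z) _ ha]; exact Multiplier.app_mem _ ha
      rw [Units.val_mul, Multiplier.app_mul _ _ ha, hs, app_res _ _ _ ha, hq, app_res _ _ _ this]
    rw [h1]
    constructor
    · intro h a ha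
      rw [← h2 a ha, ← h3 a ha, h]
    · intro h
      refine Multiplier.units_ext (θ.isIdeal₃ x y z) fun a ha => ?_
      rw [h2 a ha, h3 a ha, h a ha]
  constructor
  · intro h x y z
    rw [← key, (MonoidHom.mem_ker.1 h : θ.δ₂ w = 1)]
    rfl
  · intro h
    refine MonoidHom.mem_ker.2 ?_
    funext x y z
    exact (key x y z).2 (h x y z)

/-- The coboundary, written with values. -/
theorem eq_mul_δ₁_iff (w w' : θ.C₂) (ε : θ.C₁) : w = w' * θ.δ₁ ε ↔ ∀ x y, ∀ a ∈ θ.D₂ x y,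
    (ε (x * y)).val.app ((w x y).val.app a) =
      (w' x y).val.app (θ.map x ((ε y).val.app (θ.map x⁻¹ ((ε x).val.app a)))) := by
  have key : ∀ x y, w x y = (w' * θ.δ₁ ε) x y ↔ ∀ a ∈ θ.D₂ x y,
      (ε (x * y)).val.app ((w x y).val.app a) =
        (w' x y).val.app (θ.map x ((ε y).val.app (θ.map x⁻¹ ((ε x).val.app a)))) := by
    intro x y
    set p := θ.act₁ x y (ε y) with hp
    set q := res (θ.D₂_le_right x y) (θ.isIdeal₂ x y) (ε (x * y)) with hq
    set r := res (θ.D₂_le_left x y) (θ.isIdeal₂ x y) (ε x) with hr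
    have h1 : w x y = (w' * θ.δ₁ ε) x y ↔ q * w x y = w' x y * (p * r) := by
      change w x y = w' x y * (p * q⁻¹ * r) ↔ _
      exact eq_mul_mul_inv_mul_iff (C := (Multiplier (θ.D₂ x y))ˣ) _ _ p q r
    have h2 : ∀ a ∈ θ.D₂ x y, (w' x y * (p * r)).val.app a =
        (w' x y).val.app (θ.map x ((ε y).val.app (θ.map x⁻¹ ((ε x).val.app a)))) := fun a ha => by
      have : (ε x).val.app a ∈ θ.D₂ x y := by
        rw [← app_res (θ.D₂_le_left x y) (θ.isIdeal₂ x y) _ ha]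
        exact Multiplier.app_mem _ ha
      rw [Units.val_mul, Multiplier.app_mul _ _ ha, Units.val_mul, Multiplier.app_mul _ _ ha, hr,
        app_res _ _ _ ha, hp, θ.app_act₁ _ this]
    have h3 : ∀ a ∈ θ.D₂ x y, (q * w x y).val.app a =
        (ε (x * y)).val.app ((w x y).val.app a) := fun a ha => by
      rw [Units.val_mul, Multiplier.app_mul _ _ ha, hq, app_res _ _ _ (Multiplier.app_mem _ ha)]
    rw [h1]
    constructor
    · intro h a ha
      rw [← h2 a ha, ← h3 a ha, h]
    · intro h
      refine Multiplier.units_ext (θ.isIdeal₂ x y) fun a ha => ?_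
      rw [h2 a ha, h3 a ha, h a ha]
  constructor
  · intro h x y
    rw [← key, ← h]
  · intro h
    funext x y
    exact (key x y).2 (h x y)

end

end PartialAction

/-! ### The crossed product is an extension -/

namespace PartialAction

section
variable {G : Type v} {A : Type u} [Group G] [CommSemigroup A] [IsInverseSemigroup A]
  {θ : PartialAction G A} {w : θ.C₂}

theorem CrossedProduct.ext {p q : θ.CrossedProduct w} (h₁ : p.deg = q.deg)
    (h₂ : (p.coef : A) = q.coef) : p = q := by
  obtain ⟨x, a, ha⟩ := p
  obtain ⟨y, b, hb⟩ := q
  change x = y at h₁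
  change a = b at h₂
  subst h₁ h₂
  rfl

theorem CrossedProduct.coef_mul (p q : θ.CrossedProduct w) :
    ((p * q).coef : A) = (w p.deg q.deg).val.app (θ.tmul p.deg p.coef q.coef) := by
  rw [← coe_twistedMul, ← Multiplier.right_eq_app (θ.isIdeal₂ _ _)]
  rfl

theorem CrossedProduct.supp_coef_mul (p q : θ.CrossedProduct w) :
    supp ((p * q).coef : A) = θ.tmul p.deg (supp (p.coef : A)) (supp (q.coef : A)) := by
  rw [CrossedProduct.coef_mul, Multiplier.supp_app (θ.isIdeal₂ _ _) _
    (θ.tmul_mem₂ p.coef.2 q.coef.2), supp_tmul _ p.coef.2]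

/-- No normalization of `w` is needed. This equivalence replaces all direct computations with δ²:
being a cocycle can be transported along multiplicative bijections. -/
theorem CrossedProduct.mul_assoc_iff :
    (∀ p q r : θ.CrossedProduct w, p * q * r = p * (q * r)) ↔ w ∈ θ.Z₂ := by
  have hn : ∀ {x y z : G} {a b c : A}, a ∈ θ.D x → b ∈ θ.D y → c ∈ θ.D z →
      θ.tmul x a (θ.tmul y b c) ∈ θ.D₃ x y z := fun ha hb hc => by
    refine ⟨θ.tmul_mem ha _, θ.tmul_mem_mul ha (θ.tmul_mem hb _), ?_⟩
    rw [mul_assoc]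
    exact θ.tmul_mem_mul ha (θ.tmul_mem_mul hb hc)
  have hl : ∀ {x y z : G} {a b c : A} (ha : a ∈ θ.D x) (hb : b ∈ θ.D y) (hc : c ∈ θ.D z),
      (((⟨x, a, ha⟩ * ⟨y, b, hb⟩ * ⟨z, c, hc⟩ : θ.CrossedProduct w)).coef : A) =
        (w (x * y) z).val.app ((w x y).val.app (θ.tmul x a (θ.tmul y b c))) := by
    intro x y z a b c ha hb hc
    rw [CrossedProduct.coef_mul, CrossedProduct.coef_mul, ← θ.tmul_tmul ha hb,
      ← θ.app_tmul (θ.isIdeal₂ x y) (θ.D₂_le_right x y) _ (θ.tmul_mem₂ ha hb)]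
    rfl
  have hr : ∀ {x y z : G} {a b c : A} (ha : a ∈ θ.D x) (hb : b ∈ θ.D y) (hc : c ∈ θ.D z),
      (((⟨x, a, ha⟩ * (⟨y, b, hb⟩ * ⟨z, c, hc⟩) : θ.CrossedProduct w)).coef : A) =
        θ.map x ((w y z).val.app (θ.map x⁻¹ ((w x (y * z)).val.app
          (θ.tmul x a (θ.tmul y b c))))) := by
    intro x y z a b c ha hb hc
    have h3 := hn ha hb hc
    have h4 := θ.D₃_le₂ x y z h3
    have h5 : (w x (y * z)).val.app (θ.tmul x a (θ.tmul y b c)) ∈ θ.D₃ x y z := by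
      rw [← app_res (θ.D₃_le₂ x y z) (θ.isIdeal₃ x y z) _ h3]
      exact Multiplier.app_mem _ h3
    -- The product applies w(x,yz) last and the cocycle identity applies it first; multipliers
    -- commute.
    rw [← θ.app_act₂ _ h5, Multiplier.app_comm (θ.isIdeal₃ x y z) (θ.isIdeal₂ _ _) _ _ h3 h4,
      θ.app_act₂ _ h3, ← θ.tmul_app (θ.isIdeal₂ y z) _ ha (θ.tmul_mem₂ hb hc),
      CrossedProduct.coef_mul, CrossedProduct.coef_mul]
    rfl
  rw [mem_Z₂_iff]
  constructor
  · intro h x y z n hn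
    have hs := (θ.isIdeal x).supp_mem hn.1
    have hs₃ := (θ.isIdeal₃ x y z).supp_mem hn
    -- Idempotent second and third factors are chosen so that the untwisted triple product is `n`
    -- itself.
    have hb : θ.map x⁻¹ (supp n) ∈ θ.D₂ y z := θ.map_inv_mem₂ hs₃
    have hc : θ.map y⁻¹ (θ.map x⁻¹ (supp n)) ∈ θ.D z := (θ.map_inv_mem_iff hb.1).2 hb.2
    have e : θ.tmul x n (θ.tmul y (θ.map x⁻¹ (supp n)) (θ.map y⁻¹ (θ.map x⁻¹ (supp n)))) = n := by
      rw [θ.tmul_map hb.1 hb.1, ← θ.map_inv_mul hs hs, supp_mul_supp, θ.tmul_map hn.1 hs,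
        mul_supp_self]
    have h1 := hl hn.1 hb.1 hc
    rw [h, hr, e] at h1
    exact h1
  · rintro h ⟨x, a, ha⟩ ⟨y, b, hb⟩ ⟨z, c, hc⟩
    refine CrossedProduct.ext (mul_assoc x y z) ?_
    rw [hl ha hb hc, hr ha hb hc, h x y z _ (hn ha hb hc)]

theorem tmul_one (a b : A) : θ.tmul 1 a b = a * b := by
  unfold tmul; rw [inv_one, map_one, map_one]

theorem CrossedProduct.deg_incl_mul (a : A) (p : θ.CrossedProduct w) :
    (incl θ w a * p).deg = p.deg := one_mul _

theorem CrossedProduct.deg_mul_incl (a : A) (p : θ.CrossedProduct w) :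
    (p * incl θ w a).deg = p.deg := mul_one _

/-- Makes `CrossedProduct 1` an inverse semigroup, in which the refining semigroup lives. -/
theorem isTwisting_one : θ.IsTwisting 1 := ⟨θ.Z₂.one_mem, fun _ => ⟨rfl, rfl⟩⟩

instance : Fact (θ.IsTwisting 1) := ⟨isTwisting_one⟩

variable [hw : Fact (θ.IsTwisting w)]

namespace CrossedProduct

instance instSemigroup : Semigroup (θ.CrossedProduct w) where
  mul_assoc := mul_assoc_iff.2 hw.out.1

theorem coef_incl_mul (a : A) (p : θ.CrossedProduct w) :
    ((incl θ w a * p).coef : A) = a * p.coef := by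
  rw [coef_mul]
  change (w 1 p.deg).val.app (θ.tmul 1 a p.coef) = _
  rw [(hw.out.2 _).1, Units.val_one, Multiplier.app_one, tmul_one]

theorem coef_mul_incl (a : A) (p : θ.CrossedProduct w) :
    ((p * incl θ w a).coef : A) = θ.tmul p.deg p.coef a := by
  rw [coef_mul]
  change (w p.deg 1).val.app (θ.tmul p.deg p.coef a) = _
  rw [(hw.out.2 _).2, Units.val_one, Multiplier.app_one]

theorem incl_mul_incl (a b : A) : incl θ w (a * b) = incl θ w a * incl θ w b :=
  CrossedProduct.ext (mul_one 1).symm (coef_incl_mul a (incl θ w b)).symm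

theorem eq_incl {p : θ.CrossedProduct w} (h : p.deg = 1) : p = incl θ w p.coef :=
  CrossedProduct.ext h rfl

/-- The degree is an idempotent of the group G, and by normalization the degree 1 part is a copy of
A. -/
theorem isIdempotentElem_iff {p : θ.CrossedProduct w} :
    IsIdempotentElem p ↔ p.deg = 1 ∧ IsIdempotentElem (p.coef : A) := by
  constructor
  · intro h
    have h1 : p.deg = 1 := mul_eq_left.1 (congrArg CrossedProduct.deg h.eq)
    refine ⟨h1, ?_⟩
    have h2 := h.eq
    rw [eq_incl h1, ← incl_mul_incl] at h2
    exact congrArg (fun q => (q.coef : A)) h2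
  · rintro ⟨h1, h2⟩
    unfold IsIdempotentElem
    rw [eq_incl h1, ← incl_mul_incl, h2.eq]

/-- An element `q` with `p q p = p`. -/
noncomputable def quasiInv (p : θ.CrossedProduct w) : θ.CrossedProduct w where
  deg := p.deg⁻¹
  -- The inverse multiplier cancels the w(x,x⁻¹) created by the product. It may be applied because
  -- D_{(x,x⁻¹)} = D_x.
  coef := ⟨θ.map p.deg⁻¹ ((w p.deg p.deg⁻¹)⁻¹.val.app (sinv (p.coef : A))),
    θ.map_inv_mem (Multiplier.app_mem (I := θ.D₂ p.deg p.deg⁻¹) _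
      ⟨(θ.isIdeal _).sinv_mem p.coef.2, by
      rw [mul_inv_cancel]; exact θ.mem_D_one _⟩).1⟩

theorem mul_quasiInv (p : θ.CrossedProduct w) : p * quasiInv p = incl θ w (supp (p.coef : A)) := by
  refine CrossedProduct.ext (mul_inv_cancel _) ?_
  have h : sinv (p.coef : A) ∈ θ.D₂ p.deg p.deg⁻¹ := ⟨(θ.isIdeal _).sinv_mem p.coef.2, by
    rw [mul_inv_cancel]; exact θ.mem_D_one _⟩
  have h2 := Multiplier.app_mem (w p.deg p.deg⁻¹)⁻¹.val h
  rw [coef_mul]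
  change (w p.deg p.deg⁻¹).val.app (θ.tmul p.deg p.coef (θ.map p.deg⁻¹ _)) = supp (p.coef : A)
  rw [θ.tmul_map p.coef.2 h2.1, Multiplier.app_mul_left (θ.isIdeal₂ _ _) _ h2,
    Multiplier.app_app_inv _ h]
  rfl

theorem mul_quasiInv_mul (p : θ.CrossedProduct w) : p * quasiInv p * p = p := by
  rw [mul_quasiInv]
  exact CrossedProduct.ext (deg_incl_mul _ _) (by rw [coef_incl_mul, supp_mul_self])

instance instIsInverseSemigroup : IsInverseSemigroup (θ.CrossedProduct w) := by
  refine IsInverseSemigroup.of_regular (fun p => ⟨quasiInv p, mul_quasiInv_mul p⟩)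
    fun p q hp hq => ?_
  rw [eq_incl (isIdempotentElem_iff.1 hp).1, eq_incl (isIdempotentElem_iff.1 hq).1,
    ← incl_mul_incl, ← incl_mul_incl, mul_comm]

theorem mul_sinv_eq (p : θ.CrossedProduct w) : p * sinv p = incl θ w (supp (p.coef : A)) := by
  rw [← mul_quasiInv, mul_eq_mul_sinv (mul_quasiInv_mul p)]

/-- An idempotent of degree 1 has a coefficient equal to its own support, and supports do not see
the twisting. -/
theorem sinv_mul_eq (p : θ.CrossedProduct w) :
    sinv p * p = incl θ w (θ.map p.deg⁻¹ (supp (p.coef : A))) := by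
  have h0 := isIdempotentElem_iff.1 (isIdempotentElem_sinv_mul p)
  have h : sinv (p.coef : A) ∈ θ.D₂ p.deg p.deg⁻¹ := ⟨(θ.isIdeal _).sinv_mem p.coef.2, by
    rw [mul_inv_cancel]; exact θ.mem_D_one _⟩
  set q := quasiInv p with hq
  rw [← mul_eq_sinv_mul (mul_quasiInv_mul p)] at h0 ⊢
  refine CrossedProduct.ext h0.1 ?_
  change ((q * p).coef : A) = _
  rw [← h0.2.supp_eq, coef_mul,
    Multiplier.supp_app (θ.isIdeal₂ _ _) _ (θ.tmul_mem₂ q.coef.2 p.coef.2)]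
  set c := (w p.deg p.deg⁻¹)⁻¹.val.app (sinv (p.coef : A)) with hc
  have hc' : c ∈ θ.D p.deg := (Multiplier.app_mem (w p.deg p.deg⁻¹)⁻¹.val h).1
  change supp (θ.tmul p.deg⁻¹ (θ.map p.deg⁻¹ c) p.coef) = θ.map p.deg⁻¹ (supp p.coef)
  have e : θ.tmul p.deg⁻¹ (θ.map p.deg⁻¹ c) p.coef = θ.map p.deg⁻¹ (c * p.coef) := by
    unfold tmul
    rw [inv_inv, θ.map_map_inv hc']
  rw [e, ← θ.map_inv_supp (mul_mem hc' p.coef.2), supp_mul, hc,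
    Multiplier.supp_app (θ.isIdeal₂ _ _) _ h, supp_sinv, supp_mul_supp]

end CrossedProduct

variable (w) in
/-- The crossed product as an extension of `A` by `G`. -/
def crossedExt : GroupExt A G where
  U := θ.CrossedProduct w
  i := { toFun := CrossedProduct.incl θ w, map_mul' := CrossedProduct.incl_mul_incl }
  j := { toFun := CrossedProduct.deg, map_mul' := fun _ _ => rfl }
  i_injective a b h := congrArg (fun q : θ.CrossedProduct w => (q.coef : A)) h
  j_surjective x := by
    obtain ⟨a, ha⟩ := (θ.isIdeal x).nonempty
    exact ⟨⟨x, a, ha⟩, rfl⟩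
  range_i := by
    ext p
    constructor
    · rintro ⟨a, rfl⟩
      rfl
    · intro h
      exact ⟨p.coef, (CrossedProduct.eq_incl h).symm⟩

variable (w) in
theorem isCrossedProductExt_crossedExt : θ.IsCrossedProductExt w (crossedExt w) :=
  ⟨MulEquiv.refl _, fun _ => rfl, fun _ => rfl⟩

/-! ### The refinement of a crossed product and its transversal. -/

variable (θ) in
/-- The crossed product `E(A) *_θ G`, consisting of the `e δ_x` with `e ∈ E(D_x)`. -/
def idempotentCrossed : Subsemigroup (θ.CrossedProduct 1) where
  carrier := {p | IsIdempotentElem (p.coef : A)}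
  mul_mem' {p q} hp hq := by
    have : ((p * q).coef : A) = supp (θ.tmul p.deg p.coef q.coef) := by
      rw [supp_tmul _ p.coef.2, IsIdempotentElem.supp_eq hp, IsIdempotentElem.supp_eq hq,
        CrossedProduct.coef_mul]
      exact Multiplier.app_one _
    change IsIdempotentElem ((p * q).coef : A)
    rw [this]
    exact isIdempotentElem_supp _

theorem isIdempotentElem_map_inv {x : G} {a : A} (ha : a ∈ θ.D x) (h : IsIdempotentElem a) :
    IsIdempotentElem (θ.map x⁻¹ a) := by
  unfold IsIdempotentElem; rw [← θ.map_inv_mul ha ha, h.eq]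

instance : IsInverseSemigroup θ.idempotentCrossed := by
  refine .of_regular (fun p => ?_) fun p q hp hq => ?_
  · refine ⟨⟨CrossedProduct.quasiInv p.1, ?_⟩, Subtype.ext (CrossedProduct.mul_quasiInv_mul p.1)⟩
    change IsIdempotentElem (θ.map p.1.deg⁻¹ ((1 : Multiplier _).app (sinv (p.1.coef : A))))
    rw [Multiplier.app_one, IsIdempotentElem.sinv_eq p.2]
    exact isIdempotentElem_map_inv p.1.coef.2 p.2
  · exact Subtype.ext ((hp.map_mulHom (MulMemClass.subtype _)).comm_of_inverse
      (hq.map_mulHom (MulMemClass.subtype _)))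

theorem isIdempotentElem_idempotentCrossed {s : θ.idempotentCrossed} :
    IsIdempotentElem s ↔ s.1.deg = 1 := by
  constructor
  · intro h
    exact (CrossedProduct.isIdempotentElem_iff.1 (h.map_mulHom (MulMemClass.subtype _))).1
  · intro h
    exact Subtype.ext (CrossedProduct.isIdempotentElem_iff.2 ⟨h, s.2⟩)

/-- Going down in the order keeps the degree and multiplies the coefficient by an idempotent. This
yields both `E`-unitarity and the monotonicity of eδ_x ↦ eδ_x. -/
theorem exists_of_natLE {s t : θ.idempotentCrossed} (h : NatLE s t) :
    ∃ f : A, IsIdempotentElem f ∧ s.1.deg = t.1.deg ∧ (s.1.coef : A) = f * t.1.coef := by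
  obtain ⟨e, he, rfl⟩ := h
  have h1 := isIdempotentElem_idempotentCrossed.1 he
  refine ⟨e.1.coef, e.2, ?_, ?_⟩
  · change e.1.deg * t.1.deg = _
    rw [h1, one_mul]
  · change ((e.1 * t.1).coef : A) = _
    rw [CrossedProduct.eq_incl h1, CrossedProduct.coef_incl_mul]
    rfl

variable (w) in
/-- The refinement `A *_{(θ,w)} G → E(A) *_θ G → G`. -/
noncomputable def crossedRefinement : (crossedExt w).Refinement where
  S := θ.idempotentCrossed
  isEUnitary e s he hs := by
    obtain ⟨-, -, h, -⟩ := exists_of_natLE hs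
    rw [isIdempotentElem_idempotentCrossed] at he ⊢
    rw [← h, he]
  π :=
    { toFun := fun p : θ.CrossedProduct w => ⟨⟨p.deg, supp (p.coef : A),
        (θ.isIdeal _).supp_mem p.coef.2⟩, isIdempotentElem_supp _⟩
      map_mul' := fun p q => Subtype.ext (CrossedProduct.ext rfl
        ((CrossedProduct.supp_coef_mul (w := w) p q).trans
          ((CrossedProduct.coef_mul _ _).trans (Multiplier.app_one _)).symm)) }
  κ := { toFun := fun s => s.1.deg, map_mul' := fun _ _ => rfl }
  π_surjective s := ⟨⟨s.1.deg, s.1.coef⟩, Subtype.ext (CrossedProduct.ext rfl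
    (IsIdempotentElem.supp_eq s.2))⟩
  κ_surjective x := by
    obtain ⟨a, ha⟩ := (θ.isIdeal x).nonempty
    exact ⟨⟨⟨x, supp a, (θ.isIdeal _).supp_mem ha⟩, isIdempotentElem_supp a⟩, rfl⟩
  π_idempotent_separating p q hp hq h := by
    obtain ⟨hp₁, hp₂⟩ := (CrossedProduct.isIdempotentElem_iff (w := w)).1 hp
    obtain ⟨hq₁, hq₂⟩ := (CrossedProduct.isIdempotentElem_iff (w := w)).1 hq
    refine CrossedProduct.ext (w := w) (hp₁.trans hq₁.symm) ?_
    rw [← hp₂.supp_eq, ← hq₂.supp_eq]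
    exact congrArg (fun s : θ.idempotentCrossed => (s.1.coef : A)) h
  range_i := by
    rw [GroupExt.range_i]
    ext (p : θ.CrossedProduct w)
    exact (isIdempotentElem_idempotentCrossed (s := ⟨⟨p.deg, supp (p.coef : A),
      (θ.isIdeal _).supp_mem p.coef.2⟩, isIdempotentElem_supp _⟩)).symm
  j_eq _ := rfl

theorem coe_mul_sinv (s : θ.idempotentCrossed) :
    (s * sinv s).1 = CrossedProduct.incl θ 1 s.1.coef := by
  have : (sinv s).1 = sinv s.1 := _root_.map_sinv (MulMemClass.subtype θ.idempotentCrossed) s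
  change s.1 * (sinv s).1 = _
  rw [this, CrossedProduct.mul_sinv_eq, IsIdempotentElem.supp_eq s.2]

theorem coe_sinv_mul (s : θ.idempotentCrossed) :
    (sinv s * s).1 = CrossedProduct.incl θ 1 (θ.map s.1.deg⁻¹ s.1.coef) := by
  have : (sinv s).1 = sinv s.1 := _root_.map_sinv (MulMemClass.subtype θ.idempotentCrossed) s
  change (sinv s).1 * s.1 = _
  rw [this, CrossedProduct.sinv_mul_eq, IsIdempotentElem.supp_eq s.2]

variable (w) in
-- The transversal carries eδ_x from the untwisted to the twisted product. It respects the order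
-- because multiplication by degree 1 elements is never twisted.
theorem isExtensionOf_crossedExt : (crossedExt w).IsExtensionOf θ := by
  refine ⟨crossedRefinement w, fun s : θ.idempotentCrossed => (⟨s.1.deg, s.1.coef⟩ :
    θ.CrossedProduct w), ⟨?_, ?_, ?_⟩, ⟨?_, ?_⟩⟩
  · exact fun s => Subtype.ext (CrossedProduct.ext rfl (IsIdempotentElem.supp_eq s.2))
  · intro e he
    exact (CrossedProduct.isIdempotentElem_iff (w := w)).2
      ⟨isIdempotentElem_idempotentCrossed.1 he, e.2⟩
  · intro s t h
    obtain ⟨f, hf, h₁, h₂⟩ := exists_of_natLE h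
    refine ⟨CrossedProduct.incl θ w f, ?_, ?_⟩
    · exact (CrossedProduct.isIdempotentElem_iff (w := w)).2 ⟨rfl, hf⟩
    · refine CrossedProduct.ext (w := w) (h₁.trans (one_mul _).symm) ?_
      exact h₂.trans (CrossedProduct.coef_incl_mul (w := w) f ⟨_, _⟩).symm
  · intro x a
    constructor
    · intro ha
      refine ⟨⟨⟨x, supp a, (θ.isIdeal _).supp_mem ha⟩, isIdempotentElem_supp a⟩, rfl, ?_⟩
      change CrossedProduct.incl θ w (supp a) =
        ⟨(_ * sinv _ : θ.idempotentCrossed).1.deg, (_ * sinv _ : θ.idempotentCrossed).1.coef⟩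
      rw [coe_mul_sinv]
      rfl
    · rintro ⟨(s : θ.idempotentCrossed), rfl, h⟩
      change CrossedProduct.incl θ w (supp a) =
        ⟨(s * sinv s : θ.idempotentCrossed).1.deg, (s * sinv s : θ.idempotentCrossed).1.coef⟩ at h
      rw [coe_mul_sinv] at h
      have h1 : supp a = s.1.coef := congrArg (fun q : θ.CrossedProduct w => (q.coef : A)) h
      exact (θ.isIdeal _).mem_of_supp_mem (h1 ▸ s.1.coef.2)
  · rintro x ⟨a, ha⟩ (s : θ.idempotentCrossed) rfl h
    change CrossedProduct.incl θ w (supp a) =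
      ⟨(sinv s * s : θ.idempotentCrossed).1.deg, (sinv s * s : θ.idempotentCrossed).1.coef⟩ at h
    rw [coe_sinv_mul] at h
    have h1 : supp a = θ.map s.1.deg⁻¹ s.1.coef :=
      congrArg (fun q : θ.CrossedProduct w => (q.coef : A)) h
    rw [← θ.map_of_mem]
    change a ∈ θ.D s.1.deg⁻¹ at ha
    set p : θ.CrossedProduct w := ⟨s.1.deg, s.1.coef⟩ with hp
    change CrossedProduct.incl θ w (θ.map s.1.deg a) = p * CrossedProduct.incl θ w a * sinv p
    -- Moving aδ_1 across `p` applies θ_x to it, again without twisting; what remains of the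
    -- conjugate is `p * sinv p`.
    have h2 : p * CrossedProduct.incl θ w a = CrossedProduct.incl θ w (θ.map s.1.deg a) * p := by
      refine CrossedProduct.ext ((CrossedProduct.deg_mul_incl _ _).trans
        (CrossedProduct.deg_incl_mul _ _).symm) ?_
      rw [CrossedProduct.coef_mul_incl, CrossedProduct.coef_incl_mul]
      change θ.map s.1.deg (θ.map s.1.deg⁻¹ s.1.coef * a) = θ.map s.1.deg a * s.1.coef
      have h3 : (s.1.coef : A) = θ.map s.1.deg (supp a) := by rw [h1, θ.map_map_inv s.1.coef.2]
      rw [← h1, h3, ← θ.map_mul ha ((θ.isIdeal _).supp_mem ha), mul_comm]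
    rw [h2, mul_assoc, CrossedProduct.mul_sinv_eq, ← CrossedProduct.incl_mul_incl]
    change _ = CrossedProduct.incl θ w (_ * supp (s.1.coef : A))
    have h3 : (s.1.coef : A) = θ.map s.1.deg (supp a) := by rw [h1, θ.map_map_inv s.1.coef.2]
    rw [h3, θ.map_supp ha, supp_supp, mul_supp_self]

variable (w) in
/-- The crossed product as an extension of `(A, θ)` by `G`. -/
noncomputable def crossed : θ.Ext := ⟨crossedExt w, isExtensionOf_crossedExt w⟩

end

end PartialAction

/-! ### Cohomologous cocycles and equivalent crossed products -/

namespace PartialAction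

section
variable {G : Type v} {A : Type u} [Group G] [CommSemigroup A] [IsInverseSemigroup A]
  {θ : PartialAction G A} {w w' : θ.C₂}

/-- The isomorphism of crossed products `a δ_x ↦ ε(x)a δ_x` given by a 1-cochain. -/
noncomputable def CrossedProduct.congrOfCochain (ε : θ.C₁) (h : w = w' * θ.δ₁ ε) :
    θ.CrossedProduct w ≃* θ.CrossedProduct w' where
  toFun p := ⟨p.deg, (ε p.deg).val.app p.coef, Multiplier.app_mem _ p.coef.2⟩
  invFun p := ⟨p.deg, (ε p.deg)⁻¹.val.app p.coef, Multiplier.app_mem _ p.coef.2⟩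
  left_inv p := CrossedProduct.ext rfl (Multiplier.app_inv_app _ p.coef.2)
  right_inv p := CrossedProduct.ext rfl (Multiplier.app_app_inv _ p.coef.2)
  map_mul' p q := by
    refine CrossedProduct.ext rfl ?_
    refine Eq.trans ?_ (CrossedProduct.coef_mul _ _).symm
    change (ε (p.deg * q.deg)).val.app ((p * q).coef : A) = (w' p.deg q.deg).val.app
      (θ.tmul p.deg ((ε p.deg).val.app p.coef) ((ε q.deg).val.app q.coef))
    rw [CrossedProduct.coef_mul, (θ.eq_mul_δ₁_iff w w' ε).1 h _ _ _
      (θ.tmul_mem₂ p.coef.2 q.coef.2), θ.tmul_app (θ.isIdeal _) _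
      (Multiplier.app_mem _ p.coef.2) q.coef.2, θ.app_tmul (θ.isIdeal _) le_rfl _ p.coef.2]

/-- Associativity is pulled back along the isomorphism given by `ε`, so δ²δ¹ = 1 need not be
computed. -/
theorem mul_δ₁_mem_Z₂ (hw : w ∈ θ.Z₂) (ε : θ.C₁) : w * θ.δ₁ ε ∈ θ.Z₂ := by
  rw [← CrossedProduct.mul_assoc_iff] at hw ⊢
  intro p q r
  apply (CrossedProduct.congrOfCochain ε rfl).injective
  simp only [_root_.map_mul, hw]

theorem exists_isTwisting (hw : w ∈ θ.Z₂) : ∃ ε : θ.C₁, θ.IsTwisting (w * θ.δ₁ ε) := by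
  have hle : ∀ x, θ.D x ≤ θ.D₂ 1 1 := fun x a _ =>
    ⟨θ.mem_D_one a, by rw [mul_one]; exact θ.mem_D_one a⟩
  have htop : ∀ a : A, a ∈ θ.D₂ 1 1 := fun a => hle 1 (θ.mem_D_one a)
  -- As D_{(1,1)} = A, this multiplier restricts to every D_x and defines the 1-cochain.
  set u := (w 1 1)⁻¹ with hu
  let ε : θ.C₁ := fun x => res (hle x) (θ.isIdeal x) u
  have hε : ∀ x, ∀ a ∈ θ.D x, (ε x).val.app a = u.val.app a := fun x a ha => app_res _ _ _ ha
  have hmem : ∀ x, ∀ a ∈ θ.D x, u.val.app a ∈ θ.D x := fun x a ha => by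
    rw [← hε x a ha]; exact Multiplier.app_mem _ ha
  have hwu : ∀ a : A, (w 1 1).val.app (u.val.app a) = a := fun a =>
    Multiplier.app_app_inv _ (htop a)
  have hinj : ∀ a b : A, u.val.app a = u.val.app b → a = b := fun a b h => by
    rw [← hwu a, h, hwu]
  have hcoc := (θ.mem_Z₂_iff w).1 hw
  have hcob := (θ.eq_mul_δ₁_iff (w * θ.δ₁ ε) w ε).1 rfl
  -- The cocycle identity at (1,1,x), with one w(1,x) cancelled.
  have h1 : ∀ x, ∀ a ∈ θ.D x, (w 1 x).val.app a = (w 1 1).val.app a := by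
    intro x a ha
    have hm : a ∈ θ.D₂ 1 x := ⟨θ.mem_D_one a, by rwa [one_mul]⟩
    have h := hcoc 1 1 x a ⟨θ.mem_D_one a, by rw [mul_one]; exact θ.mem_D_one a, by
      rwa [mul_one, one_mul]⟩
    rw [inv_one, map_one, map_one] at h
    rw [one_mul, one_mul] at h
    have h' := congrArg (w 1 x)⁻¹.val.app h
    rw [Multiplier.app_inv_app _ (Multiplier.app_mem _ hm)] at h'
    rw [h', Multiplier.app_inv_app]
    refine ⟨θ.mem_D_one _, ?_⟩
    rw [one_mul, ← mul_supp_self a, Multiplier.app_mul_right (θ.isIdeal₂ 1 1) _ (htop a)]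
    exact (θ.isIdeal x).mul_mem_left _ _ ((θ.isIdeal x).supp_mem ha)
  -- The cocycle identity at (x,1,1), evaluated at w(x,1)⁻¹a.
  have h2 : ∀ x, ∀ a ∈ θ.D x,
      (w x 1).val.app a = θ.map x ((w 1 1).val.app (θ.map x⁻¹ a)) := by
    intro x a ha
    have hm : ∀ b ∈ θ.D x, b ∈ θ.D₂ x 1 := fun b hb => ⟨hb, by rwa [mul_one]⟩
    have hb : (w x 1)⁻¹.val.app a ∈ θ.D x := (Multiplier.app_mem _ (hm a ha)).1
    have h := hcoc x 1 1 _ ⟨hb, by rwa [mul_one], by rwa [mul_one, mul_one]⟩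
    rw [mul_one, mul_one] at h
    rw [Multiplier.app_app_inv _ (hm a ha)] at h
    exact h.symm
  refine ⟨ε, mul_δ₁_mem_Z₂ hw ε, fun x => ⟨?_, ?_⟩⟩
  · refine Multiplier.units_ext (θ.isIdeal₂ 1 x) fun a ha => ?_
    have hx : a ∈ θ.D x := by have := ha.2; rwa [one_mul] at this
    have h := hcob 1 x a ha
    rw [inv_one, map_one, map_one, hε _ _ (Multiplier.app_mem _ ha).2, hε _ a ha.1,
      hε _ _ (hmem x a hx), h1 x _ (hmem _ _ (hmem x a hx)), hwu] at h
    rw [hinj _ _ h, Units.val_one, Multiplier.app_one]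
  · refine Multiplier.units_ext (θ.isIdeal₂ x 1) fun a ha => ?_
    have h := hcob x 1 a ha
    have h3 := θ.map_inv_mem (hmem x a ha.1)
    rw [hε _ _ (Multiplier.app_mem _ ha).2, hε _ a ha.1, hε _ _ (θ.mem_D_one _),
      h2 x _ (θ.map_mem (hmem _ _ h3)), θ.map_inv_map (hmem _ _ h3), hwu,
      θ.map_map_inv (hmem x a ha.1)] at h
    rw [hinj _ _ h, Units.val_one, Multiplier.app_one]

theorem mk_eq_mk_iff {w w' : θ.Z₂} :
    H₂.mk θ w = H₂.mk θ w' ↔ ∃ ε : θ.C₁, w.1 = w'.1 * θ.δ₁ ε := by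
  unfold H₂.mk
  rw [eq_comm, QuotientGroup.eq, Subgroup.mem_subgroupOf]
  constructor
  · rintro ⟨ε, h⟩
    refine ⟨ε, ?_⟩
    rw [h]
    exact (mul_inv_cancel_left w'.1 w.1).symm
  · rintro ⟨ε, h⟩
    refine ⟨ε, ?_⟩
    change _ = w'.1⁻¹ * w.1
    rw [h, inv_mul_cancel_left]

theorem exists_isTwisting_mk_eq (c : θ.H₂) : ∃ w : θ.Z₂, θ.IsTwisting w ∧ H₂.mk θ w = c := by
  obtain ⟨w, rfl⟩ := QuotientGroup.mk_surjective c
  obtain ⟨ε, h⟩ := exists_isTwisting w.2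
  exact ⟨⟨_, h.1⟩, h, mk_eq_mk_iff.2 ⟨ε, rfl⟩⟩

/-- An equivalence has the form aδ_x ↦ ε(x)a δ_x; comparing the images of products gives exactly the
coboundary relation. -/
theorem crossedExt_equivalent_iff [hw : Fact (θ.IsTwisting w)] [hw' : Fact (θ.IsTwisting w')] :
    (crossedExt w).Equivalent (crossedExt w') ↔ ∃ ε : θ.C₁, w = w' * θ.δ₁ ε := by
  constructor
  · rintro ⟨μ, hi, hj⟩
    change θ.CrossedProduct w ≃* θ.CrossedProduct w' at μ
    change ∀ a, μ (CrossedProduct.incl θ w a) = CrossedProduct.incl θ w' a at hi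
    change ∀ p : θ.CrossedProduct w, (μ p).deg = p.deg at hj
    classical
    let F : G → A → A := fun x a => if h : a ∈ θ.D x then (μ ⟨x, a, h⟩).coef else a
    have hF : ∀ {x a} (h : a ∈ θ.D x), F x a = (μ ⟨x, a, h⟩).coef := fun h => dif_pos h
    have hm : ∀ x a b, a ∈ θ.D x → F x (a * b) = F x a * b := fun x a b ha => by
      rw [hF ha, hF ((θ.isIdeal x).mul_mem_right _ _ ha)]
      have : (⟨x, a * b, (θ.isIdeal x).mul_mem_right _ _ ha⟩ : θ.CrossedProduct w) =
          CrossedProduct.incl θ w b * ⟨x, a, ha⟩ :=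
        CrossedProduct.ext (one_mul x).symm 
          ((mul_comm a b).trans (CrossedProduct.coef_incl_mul b ⟨x, a, ha⟩).symm)
      rw [this, _root_.map_mul, hi, CrossedProduct.coef_incl_mul, mul_comm]
    -- The support is read off from `p * sinv p`, which lies in the image of A and is therefore
    -- fixed by `μ`.
    have hs : ∀ x a, a ∈ θ.D x → supp (F x a) = supp a := fun x a ha => by
      have h1 := congrArg μ (CrossedProduct.mul_sinv_eq (⟨x, a, ha⟩ : θ.CrossedProduct w))
      have h2 : μ (sinv ⟨x, a, ha⟩) = sinv (μ ⟨x, a, ha⟩) := _root_.map_sinv μ.toMulHom _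
      rw [_root_.map_mul, h2, CrossedProduct.mul_sinv_eq, hi, ← hF] at h1
      exact congrArg (fun p : θ.CrossedProduct w' => (p.coef : A)) h1
    let ε : θ.C₁ := fun x => Multiplier.unitOfMap (θ.isIdeal x) (F x) (hm x) (hs x)
    have hε : ∀ {x a}, a ∈ θ.D x → (ε x).val.app a = F x a := fun {x a} h =>
      Multiplier.app_unitOfMap (θ.isIdeal x) (F x) (hm x) (hs x) h
    have hμ : ∀ {x a} (h : a ∈ θ.D x),
        μ ⟨x, a, h⟩ = ⟨x, (ε x).val.app a, Multiplier.app_mem _ h⟩ := fun h =>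
      CrossedProduct.ext (hj _) ((hF h).symm.trans (hε h).symm)
    refine ⟨ε, (θ.eq_mul_δ₁_iff w w' ε).2 fun x y m hm => ?_⟩
    have hs := (θ.isIdeal₂ x y).supp_mem hm
    have hy : θ.map x⁻¹ (supp m) ∈ θ.D y := (θ.map_inv_mem_iff hs.1).2 hs.2
    -- Every `m` in D_{(x,y)} occurs as an untwisted product, so applying `μ` to this one product
    -- tests the coboundary relation at `m`.
    have h1 : (⟨x, m, hm.1⟩ * ⟨y, _, hy⟩ : θ.CrossedProduct w) =
        ⟨x * y, (w x y).val.app m, (Multiplier.app_mem _ hm).2⟩ :=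
      CrossedProduct.ext rfl (by
        rw [CrossedProduct.coef_mul]
        change (w x y).val.app (θ.tmul x m (θ.map x⁻¹ (supp m))) = (w x y).val.app m
        rw [θ.tmul_map hm.1 hs.1, mul_supp_self])
    have h2 := congrArg μ h1
    rw [_root_.map_mul, hμ hm.1, hμ hy, hμ] at h2
    replace h2 := congrArg (fun p : θ.CrossedProduct w' => (p.coef : A)) h2
    rw [CrossedProduct.coef_mul] at h2
    refine h2.symm.trans ?_
    change (w' x y).val.app (θ.tmul x _ _) = _
    rw [θ.tmul_app (θ.isIdeal y) _ (Multiplier.app_mem _ hm.1) hy,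
      θ.tmul_map (Multiplier.app_mem _ hm.1) hs.1, Multiplier.app_mul_supp (θ.isIdeal x) _ hm.1]
  · rintro ⟨ε, h⟩
    refine ⟨CrossedProduct.congrOfCochain ε h, fun a => ?_, fun p => rfl⟩
    refine CrossedProduct.ext rfl ?_
    change (ε 1).val.app a = a
    have ha := θ.mem_D_one a
    -- At (1,1) both normalized twistings disappear, leaving ε(1)a = ε(1)ε(1)a, so ε(1) = 1 and A is
    -- fixed.
    have h1 := (θ.eq_mul_δ₁_iff w w' ε).1 h 1 1 a ⟨ha, by rwa [mul_one]⟩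
    rw [(hw.out.2 1).1, (hw'.out.2 1).1, inv_one, map_one, map_one, Units.val_one,
      Multiplier.app_one, Multiplier.app_one, mul_one] at h1
    have h2 := congrArg (ε 1)⁻¹.val.app h1
    rw [Multiplier.app_inv_app _ ha, Multiplier.app_inv_app _ (Multiplier.app_mem _ ha)] at h2
    exact h2.symm

end

end PartialAction

/-! ### Every extension is a crossed product -/

theorem sinv_conj_mul {S : Type u} [Semigroup S] [IsInverseSemigroup S] {g : S}
    (hg : IsIdempotentElem g) (s : S) : s * (sinv s * g * s) = g * s := by
  rw [← mul_assoc, ← mul_assoc, (isIdempotentElem_mul_sinv s).comm_of_inverse hg, mul_assoc,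
    mul_sinv_mul]

theorem isIdempotentElem_sinv_conj {S : Type u} [Semigroup S] [IsInverseSemigroup S] {g : S}
    (hg : IsIdempotentElem g) (s : S) : IsIdempotentElem (sinv s * g * s) := by
  unfold IsIdempotentElem
  rw [mul_assoc (sinv s * g), sinv_conj_mul hg, mul_assoc, ← mul_assoc g, hg.eq, ← mul_assoc]

namespace GroupExt

section
variable {A : Type u} {G : Type v} [CommSemigroup A] [Group G] [IsInverseSemigroup A]
  {E : GroupExt A G}

theorem i_sinv (a : A) : E.i (sinv a) = sinv (E.i a) := map_sinv E.i a

theorem j_i (a : A) : E.j (E.i a) = 1 := by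
  have : E.i a ∈ Set.range E.i := ⟨a, rfl⟩
  rw [E.range_i] at this
  exact this

/-! ### Factorization of an extension through a transversal. -/

namespace Refinement

theorem isIdempotentElem_π_i (R : E.Refinement) (a : A) : IsIdempotentElem (R.π (E.i a)) := by
  have : E.i a ∈ Set.range E.i := ⟨a, rfl⟩
  rw [R.range_i] at this
  exact this

theorem π_i_supp (R : E.Refinement) (a : A) : R.π (E.i (supp a)) = R.π (E.i a) := by
  have h := R.isIdempotentElem_π_i a
  unfold supp
  rw [map_mul, i_sinv, map_mul, map_sinv, h.sinv_eq, h.eq]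

/-- Both κ⁻¹(1) and E(S) have the preimage i(A) under the surjection π. -/
theorem isIdempotentElem_of_κ_eq_one (R : E.Refinement) {s : R.S} (h : R.κ s = 1) :
    IsIdempotentElem s := by
  obtain ⟨p, rfl⟩ := R.π_surjective s
  have hp : p ∈ Set.range E.i := by
    rw [E.range_i]
    exact (R.j_eq p).trans h
  rw [R.range_i] at hp
  exact hp

/-- The element f = t⁻¹s has trivial image in G, so it is idempotent; then s = tf and t = sf give s
= t. -/
theorem eq_of_κ_eq (R : E.Refinement) {s t : R.S} (h : R.κ s = R.κ t)
    (h' : s * sinv s = t * sinv t) : s = t := by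
  have hf : IsIdempotentElem (sinv t * s) := R.isIdempotentElem_of_κ_eq_one (by
    rw [map_mul, map_sinv_eq_inv, h, inv_mul_cancel])
  have h1 : s = t * (sinv t * s) := by rw [← mul_assoc, ← h', mul_sinv_mul]
  have h2 : t = s * (sinv t * s) := by
    rw [← hf.sinv_eq, sinv_mul_rev, sinv_sinv, ← mul_assoc, h', mul_sinv_mul]
  rw [h1]
  conv_lhs => rw [h2]
  rw [mul_assoc s, ← h2, hf.eq, ← h2]

namespace IsOrderPreservingTransversal

variable {R : E.Refinement} {ρ : R.S → E.U} (hρ : R.IsOrderPreservingTransversal ρ)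
include hρ

theorem ρ_π {e : E.U} (he : IsIdempotentElem e) : ρ (R.π e) = e :=
  R.π_idempotent_separating _ _ (hρ.map_idempotent _ (he.map_mulHom R.π)) he (hρ.π_comp _)

theorem ρ_mul_sinv (p : E.U) : ρ (R.π p) * sinv (ρ (R.π p)) = p * sinv p :=
  R.π_idempotent_separating _ _ (isIdempotentElem_mul_sinv _) (isIdempotentElem_mul_sinv _)
    (by rw [map_mul, map_mul, map_sinv, map_sinv, hρ.π_comp])

theorem sinv_mul_ρ (p : E.U) : sinv (ρ (R.π p)) * ρ (R.π p) = sinv p * p :=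
  R.π_idempotent_separating _ _ (isIdempotentElem_sinv_mul _) (isIdempotentElem_sinv_mul _)
    (by rw [map_mul, map_mul, map_sinv, map_sinv, hρ.π_comp])

/-- Monotonicity provides some idempotent `g` with ρ(π(e)s) = gρ(s); after applying π, separation of
idempotents shows that `g` and `e` agree below ρ(s)ρ(s)⁻¹. -/
theorem ρ_π_mul {e : E.U} (he : IsIdempotentElem e) (s : R.S) : ρ (R.π e * s) = e * ρ s := by
  obtain ⟨g, hg, h⟩ := hρ.monotone (R.π e * s) s ⟨_, he.map_mulHom R.π, rfl⟩
  have h1 := congrArg R.π h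
  rw [hρ.π_comp, map_mul, hρ.π_comp] at h1
  have h2 : g * (ρ s * sinv (ρ s)) = e * (ρ s * sinv (ρ s)) :=
    R.π_idempotent_separating _ _ (hg.mul_of_inverse (isIdempotentElem_mul_sinv _))
      (he.mul_of_inverse (isIdempotentElem_mul_sinv _)) (by
        simp only [map_mul, hρ.π_comp, ← mul_assoc, h1])
  rw [h, ← mul_sinv_mul (ρ s), ← mul_assoc g, h2, mul_assoc e]

theorem ρ_mul_π {e : E.U} (he : IsIdempotentElem e) (s : R.S) : ρ (s * R.π e) = ρ s * e := by
  have he' := he.map_mulHom R.π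
  -- The order is defined by left multiplication, so the idempotent is first conjugated to the left
  -- of `s`.
  have hle : s * R.π e = sinv (sinv s) * R.π e * sinv s * s := by
    rw [sinv_sinv, mul_assoc, mul_assoc s, ← he'.comm_of_inverse (isIdempotentElem_sinv_mul s)
      |>.symm, ← mul_assoc, ← mul_assoc, mul_sinv_mul]
  obtain ⟨g, hg, h⟩ := hρ.monotone (s * R.π e) s
    ⟨_, isIdempotentElem_sinv_conj he' (sinv s), hle⟩
  have h1 := congrArg R.π h
  rw [hρ.π_comp, map_mul, hρ.π_comp] at h1
  have h2 : sinv (ρ s) * g * ρ s = sinv (ρ s) * ρ s * e :=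
    R.π_idempotent_separating _ _ (isIdempotentElem_sinv_conj hg _)
      ((isIdempotentElem_sinv_mul _).mul_of_inverse he) (by
        simp only [map_mul, hρ.π_comp, mul_assoc, h1])
  rw [h, ← sinv_conj_mul hg, h2, ← mul_assoc, ← mul_assoc, mul_sinv_mul]

theorem exists_coef (p : E.U) : ∃ a, E.i a = p * sinv (ρ (R.π p)) := by
  have : p * sinv (ρ (R.π p)) ∈ Set.range E.i := by
    rw [R.range_i]
    change IsIdempotentElem _
    rw [map_mul, map_sinv, hρ.π_comp]
    exact isIdempotentElem_mul_sinv _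
  exact this

/-- The coefficient `a` in the factorization `p = i(a) ρ(π(p))`. -/
noncomputable def coef (p : E.U) : A := (hρ.exists_coef p).choose

theorem i_coef (p : E.U) : E.i (hρ.coef p) = p * sinv (ρ (R.π p)) := (hρ.exists_coef p).choose_spec

theorem i_coef_mul (p : E.U) : E.i (hρ.coef p) * ρ (R.π p) = p := by
  rw [i_coef, mul_assoc, hρ.sinv_mul_ρ, ← mul_assoc, mul_sinv_mul]

theorem i_supp_coef (p : E.U) : E.i (supp (hρ.coef p)) = p * sinv p := by
  unfold supp
  rw [map_mul, i_sinv, i_coef, sinv_mul_rev, sinv_sinv, mul_assoc, ← mul_assoc (sinv _),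
    hρ.sinv_mul_ρ, mul_assoc, ← mul_assoc p, ← mul_assoc, mul_sinv_mul]

theorem coef_i_mul (b : A) (p : E.U) : hρ.coef (E.i b * p) = b * hρ.coef p := by
  apply E.i_injective
  have hs : IsIdempotentElem (E.i (supp b)) := (isIdempotentElem_supp b).map_mulHom E.i
  rw [i_coef, map_mul R.π, ← R.π_i_supp, hρ.ρ_π_mul hs, sinv_mul_rev, hs.sinv_eq, mul_assoc,
    ← mul_assoc p, ← i_coef, ← map_mul, ← map_mul, mul_comm _ (supp b), ← mul_assoc,
    mul_supp_self]

theorem coef_i (a : A) : hρ.coef (E.i a) = a := by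
  apply E.i_injective
  have hs : IsIdempotentElem (E.i (supp a)) := (isIdempotentElem_supp a).map_mulHom E.i
  rw [i_coef, ← R.π_i_supp, hρ.ρ_π hs, hs.sinv_eq, ← map_mul, mul_supp_self]

/-- The coefficient determines pp⁻¹ through its support, and with the degree this determines π(p),
hence p = i(a)ρ(π(p)). -/
theorem eq_of_coef_eq {p q : E.U} (h : E.j p = E.j q) (h' : hρ.coef p = hρ.coef q) : p = q := by
  have h1 : p * sinv p = q * sinv q := by rw [← hρ.i_supp_coef, h', hρ.i_supp_coef]
  have h2 : R.π p = R.π q := R.eq_of_κ_eq (by rw [← R.j_eq, h, R.j_eq]) (by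
    rw [← map_sinv, ← map_mul, h1, map_mul, map_sinv])
  rw [← hρ.i_coef_mul p, h', h2, hρ.i_coef_mul]

variable {θ : PartialAction G A} (hI : R.Induces ρ θ)
include hI

theorem coef_mem (p : E.U) : hρ.coef p ∈ θ.D (E.j p) := by
  rw [hI.mem_D_iff]
  refine ⟨R.π p, (R.j_eq p).symm, (hρ.i_supp_coef p).trans ?_⟩
  rw [← map_sinv, ← map_mul, hρ.ρ_π (isIdempotentElem_mul_sinv p)]

theorem exists_coef_eq {x : G} {a : A} (ha : a ∈ θ.D x) : ∃ p, E.j p = x ∧ hρ.coef p = a := by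
  obtain ⟨s, rfl, h⟩ := (hI.mem_D_iff x a).1 ha
  refine ⟨E.i a * ρ s, ?_, ?_⟩
  · rw [map_mul, j_i, one_mul, R.j_eq, hρ.π_comp]
  · rw [coef_i_mul]
    have : hρ.coef (ρ s) = supp a := by
      apply E.i_injective
      rw [i_coef, hρ.π_comp]
      refine Eq.trans ?_ h.symm
      refine R.π_idempotent_separating _ _ (isIdempotentElem_mul_sinv _)
        (hρ.map_idempotent _ (isIdempotentElem_mul_sinv s)) ?_
      rw [map_mul, map_sinv, hρ.π_comp, hρ.π_comp]
    rw [this, mul_supp_self]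

/-- Writing p = i(a)ρ(s), right multiplication by i(b) becomes conjugation of i(b) by ρ(s), which is
the induced θ_x. -/
theorem coef_mul_i (p : E.U) (b : A) :
    hρ.coef (p * E.i b) = θ.tmul (E.j p) (hρ.coef p) b := by
  set a := hρ.coef p with ha
  set x := E.j p with hx
  set s := R.π p with hs
  have hκ : R.κ s = x := (R.j_eq p).symm
  have hmem : a ∈ θ.D x := hρ.coef_mem hI p
  set d := supp (hρ.coef (sinv p)) with hd
  have hdi : IsIdempotentElem d := isIdempotentElem_supp _
  have hdmem : d ∈ θ.D x⁻¹ := by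
    have := hρ.coef_mem hI (sinv p)
    rw [map_sinv_eq_inv] at this
    exact (θ.isIdeal _).supp_mem this
  have hid : E.i d = sinv p * p := by rw [hd, i_supp_coef, sinv_sinv]
  have hρs : sinv (ρ s) * ρ s = E.i d := by rw [hs, hρ.sinv_mul_ρ, hid]
  have hρd : ρ s * E.i d = ρ s := by rw [← hρs, ← mul_assoc, mul_sinv_mul]
  -- The induced action at `d * b` needs a representative whose domain idempotent is the support of
  -- `d * b`: `s` is cut down by the support of `b`, and `ρ_mul_π` controls ρ there.
  have key : ∀ b, E.i (θ.map x (d * b)) = ρ s * E.i b * sinv (ρ s) := by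
    intro b
    have hg : IsIdempotentElem (E.i (supp b)) := (isIdempotentElem_supp b).map_mulHom E.i
    have hdb : d * b ∈ θ.D x⁻¹ := (θ.isIdeal _).mul_mem_right _ _ hdmem
    have h1 : ρ (s * R.π (E.i (supp b))) = ρ s * E.i (supp b) := hρ.ρ_mul_π hg s
    have h2 : E.i (d * b * sinv (d * b)) =
        ρ (sinv (s * R.π (E.i (supp b))) * (s * R.π (E.i (supp b)))) := by
      have e : R.π (sinv (p * E.i (supp b)) * (p * E.i (supp b))) =
          sinv (s * R.π (E.i (supp b))) * (s * R.π (E.i (supp b))) := by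
        rw [map_mul, map_sinv, map_mul]
      rw [← e, hρ.ρ_π (isIdempotentElem_sinv_mul _), sinv_mul_rev p, hg.sinv_eq,
        mul_assoc (E.i _), ← mul_assoc (sinv p), ← hid, ← map_mul, ← map_mul]
      change E.i (supp (d * b)) = _
      rw [supp_mul, hdi.supp_eq, mul_comm d, ← mul_assoc, supp_mul_supp]
    have h3 := hI.θ_apply x ⟨d * b, hdb⟩ (s * R.π (E.i (supp b))) (by
      rw [map_mul, hκ, map_idempotent_eq_one (R.isIdempotentElem_π_i _), mul_one]) h2
    rw [← θ.map_of_mem, h1, sinv_mul_rev, hg.sinv_eq] at h3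
    rw [h3, ← mul_assoc, mul_assoc (ρ s), ← map_mul, mul_assoc (ρ s), ← map_mul,
      show supp b * (d * b) * supp b = d * b by
        rw [mul_left_comm, supp_mul_self, mul_assoc, mul_supp_self], map_mul, ← mul_assoc, hρd]
  have hda : θ.map x d = supp a := by
    apply E.i_injective
    have := key d
    rw [hdi.eq, hρd] at this
    rw [this, hs, hρ.ρ_mul_sinv, ha, i_supp_coef]
  have hda' : d = θ.map x⁻¹ (supp a) := by rw [← hda, θ.map_inv_map hdmem]
  have hg : IsIdempotentElem (E.i (supp b)) := (isIdempotentElem_supp b).map_mulHom E.i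
  apply E.i_injective
  rw [i_coef, map_mul R.π, ← R.π_i_supp, hρ.ρ_mul_π hg, sinv_mul_rev, hg.sinv_eq, ← mul_assoc,
    mul_assoc p, ← map_mul, mul_supp_self]
  conv_lhs => enter [1, 1]; rw [← hρ.i_coef_mul p]
  rw [mul_assoc, mul_assoc, ← mul_assoc (ρ _), ← hs, ← key b, ← ha, ← map_mul, hda']
  change E.i (a * θ.tmul x (supp a) b) = _
  rw [← θ.mul_tmul ((θ.isIdeal _).supp_mem hmem), mul_supp_self]

theorem exists_isTwisting : ∃ w : θ.C₂, θ.IsTwisting w ∧ θ.IsCrossedProductExt w E := by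
  -- `ψ` inverts p ↦ (j(p), coef p); its value outside D_x is arbitrary.
  have hψ : ∀ x a, ∃ p, a ∈ θ.D x → E.j p = x ∧ hρ.coef p = a := fun x a => by
    by_cases h : a ∈ θ.D x
    · obtain ⟨p, hp⟩ := hρ.exists_coef_eq hI h
      exact ⟨p, fun _ => hp⟩
    · exact ⟨E.i a, fun h' => absurd h' h⟩
  choose ψ hψ using hψ
  have hj : ∀ {x a}, a ∈ θ.D x → E.j (ψ x a) = x := fun h => (hψ _ _ h).1
  have hc : ∀ {x a}, a ∈ θ.D x → hρ.coef (ψ x a) = a := fun h => (hψ _ _ h).2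
  have hψj : ∀ p, ψ (E.j p) (hρ.coef p) = p := fun p =>
    hρ.eq_of_coef_eq (hj (hρ.coef_mem hI p)) (hc (hρ.coef_mem hI p))
  have hil : ∀ {x a} (b), a ∈ θ.D x → ψ x (b * a) = E.i b * ψ x a := fun {x a} b h => by
    have h' : b * a ∈ θ.D x := (θ.isIdeal x).mul_mem_left _ _ h
    refine hρ.eq_of_coef_eq ?_ ?_
    · rw [hj h', map_mul, j_i, one_mul, hj h]
    · rw [hc h', coef_i_mul, hc h]
  have hir : ∀ {x a} (b), a ∈ θ.D x → ψ x a * E.i b = ψ x (θ.tmul x a b) := fun {x a} b h => by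
    have h' := θ.tmul_mem h b
    refine hρ.eq_of_coef_eq ?_ ?_
    · rw [hj h', map_mul, j_i, mul_one, hj h]
    · rw [hc h', hρ.coef_mul_i hI, hc h, hj h]
  -- In a crossed product, w(x,y)m is the coefficient of mδ_x · θ_x⁻¹(mm⁻¹)δ_y; here this serves as
  -- the definition.
  let F : G → G → A → A := fun x y m => hρ.coef (ψ x m * ψ y (θ.map x⁻¹ (supp m)))
  have hmem : ∀ {x y m}, m ∈ θ.D₂ x y → θ.map x⁻¹ (supp m) ∈ θ.D y := fun {x y m} hm =>
    (θ.map_inv_mem_iff ((θ.isIdeal _).supp_mem hm.1)).2 ((θ.isIdeal _).supp_mem hm.2)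
  have hs : ∀ x y m, m ∈ θ.D₂ x y → supp (F x y m) = supp m := fun x y m hm => by
    apply E.i_injective
    change E.i (supp (hρ.coef (ψ x m * ψ y (θ.map x⁻¹ (supp m))))) = _
    have h1 : E.i (supp (θ.map x⁻¹ (supp m))) =
        ψ y (θ.map x⁻¹ (supp m)) * sinv (ψ y (θ.map x⁻¹ (supp m))) := by
      rw [← hρ.i_supp_coef, hc (hmem hm)]
    rw [i_supp_coef, sinv_mul_rev, mul_assoc, ← mul_assoc (ψ y _), ← h1, ← mul_assoc, hir _ hm.1,
      ← θ.map_inv_supp ((θ.isIdeal _).supp_mem hm.1), supp_supp,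
      θ.tmul_map hm.1 ((θ.isIdeal _).supp_mem hm.1), mul_supp_self, ← hρ.i_supp_coef, hc hm.1]
  have hm : ∀ x y m b, m ∈ θ.D₂ x y → F x y (m * b) = F x y m * b := fun x y m b hm => by
    have hsm := (θ.isIdeal x).supp_mem hm.1
    have hmb : m * b ∈ θ.D₂ x y := (θ.isIdeal₂ x y).mul_mem_right _ _ hm
    have hsmb := (θ.isIdeal x).supp_mem hmb.1
    have h1 : θ.map x⁻¹ (supp (m * b)) = θ.map x⁻¹ (supp (m * b)) * θ.map x⁻¹ (supp m) := by
      rw [← θ.map_inv_mul hsmb hsm, supp_mul, mul_right_comm, supp_mul_supp]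
    change hρ.coef (ψ x (m * b) * ψ y (θ.map x⁻¹ (supp (m * b)))) = F x y m * b
    rw [h1, hil _ (hmem hm), mul_comm m b, hil _ hm.1, mul_assoc, ← mul_assoc (ψ x m),
      mul_comm b m, hir _ hm.1, θ.tmul_map hm.1 hsmb, mul_comm m (supp _), hil _ hm.1, mul_assoc,
      coef_i_mul, coef_i_mul]
    change b * (supp (m * b) * F x y m) = F x y m * b
    rw [supp_mul, ← hs x y m hm, mul_comm (supp (F x y m)), mul_assoc (supp b), supp_mul_self,
      ← mul_assoc, mul_supp_self, mul_comm]
  let w : θ.C₂ := fun x y => Multiplier.unitOfMap (θ.isIdeal₂ x y) (F x y) (hm x y) (hs x y)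
  have hw : ∀ {x y m}, m ∈ θ.D₂ x y → (w x y).val.app m = F x y m := fun {x y m} h =>
    Multiplier.app_unitOfMap (θ.isIdeal₂ x y) (F x y) (hm x y) (hs x y) h
  let φ : E.U → θ.CrossedProduct w := fun p => ⟨E.j p, hρ.coef p, hρ.coef_mem hI p⟩
  have hφ : Function.Bijective φ := by
    constructor
    · intro p q h
      exact hρ.eq_of_coef_eq (congrArg PartialAction.CrossedProduct.deg h)
        (congrArg (fun r : θ.CrossedProduct w => (r.coef : A)) h)
    · rintro ⟨x, a, ha⟩
      exact ⟨ψ x a, PartialAction.CrossedProduct.ext (hj ha) (hc ha)⟩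
  have hmul : ∀ p q, φ (p * q) = φ p * φ q := fun p q => by
    refine PartialAction.CrossedProduct.ext (map_mul E.j p q) ?_
    rw [PartialAction.CrossedProduct.coef_mul]
    have hp := hρ.coef_mem hI p
    have hq := hρ.coef_mem hI q
    change hρ.coef (p * q) =
      (w (E.j p) (E.j q)).val.app (θ.tmul (E.j p) (hρ.coef p) (hρ.coef q))
    rw [hw (θ.tmul_mem₂ hp hq)]
    change hρ.coef (p * q) = hρ.coef _
    congr 1
    obtain ⟨x, hx⟩ : ∃ x, x = E.j p := ⟨_, rfl⟩
    obtain ⟨y, hy⟩ : ∃ y, y = E.j q := ⟨_, rfl⟩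
    obtain ⟨a, ha⟩ : ∃ a, a = hρ.coef p := ⟨_, rfl⟩
    obtain ⟨b, hb⟩ : ∃ b, b = hρ.coef q := ⟨_, rfl⟩
    have hsb : supp b ∈ θ.D y := by rw [hb, hy]; exact (θ.isIdeal _).supp_mem hq
    have ep : p = ψ x a := by rw [hx, ha, hψj]
    -- The factor i(b) is moved into `p`, giving pq = ψ_x(m)ψ_y(bb⁻¹) with m the untwisted product.
    have eq : q = E.i b * ψ y (supp b) := by rw [← hil b hsb, mul_supp_self, hy, hb, hψj]
    have hpa : a ∈ θ.D x := by rw [ha, hx]; exact hp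
    rw [← hx, ← hy, ← ha, ← hb]
    set m := θ.tmul x a b with hm'
    have hmx : m ∈ θ.D x := θ.tmul_mem hpa b
    -- As θ_x⁻¹(m) is a multiple of `b`, the second factor in `F` lies below ψ_y(bb⁻¹), and ψ_x(m)
    -- absorbs the difference.
    have h1 : θ.map x⁻¹ (supp m) = θ.map x⁻¹ (supp m) * supp b := by
      rw [θ.map_inv_supp hmx, hm']
      unfold PartialAction.tmul
      rw [θ.map_inv_map (θ.map_inv_mul_mem hpa b), supp_mul, mul_assoc, supp_mul_supp]
    have h2 : ψ x m * E.i (θ.map x⁻¹ (supp m)) = ψ x m := by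
      rw [hir _ hmx, θ.tmul_map hmx ((θ.isIdeal _).supp_mem hmx), mul_supp_self]
    rw [h1, hil _ hsb, ← mul_assoc (ψ x m), h2, ep, eq, ← mul_assoc, hir _ hpa]
  have hinc : ∀ a, φ (E.i a) = PartialAction.CrossedProduct.incl θ w a := fun a =>
    PartialAction.CrossedProduct.ext (j_i a) (hρ.coef_i a)
  let e : E.U ≃* θ.CrossedProduct w := MulEquiv.ofBijective (MulHom.mk φ hmul) hφ
  -- Associativity of U passes to the crossed product.
  have hZ : w ∈ θ.Z₂ := by
    rw [← PartialAction.CrossedProduct.mul_assoc_iff]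
    intro p q r
    apply e.symm.injective
    simp only [map_mul, mul_assoc]
  refine ⟨w, ⟨hZ, fun x => ⟨?_, ?_⟩⟩, e, hinc, fun _ => rfl⟩
  · refine Multiplier.units_ext (θ.isIdeal₂ 1 x) fun m hm => ?_
    have hx : m ∈ θ.D x := by have := hm.2; rwa [one_mul] at this
    -- The product i(mm⁻¹)ψ_x(m) has coefficient `m`, and the twisted formula gives w(1,x)m.
    have h1 := congrArg (fun p : θ.CrossedProduct w => (p.coef : A)) (hmul (E.i (supp m)) (ψ x m))
    simp only [PartialAction.CrossedProduct.coef_mul] at h1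
    change hρ.coef (E.i (supp m) * ψ x m) = (w (E.j (E.i (supp m))) (E.j (ψ x m))).val.app
      (θ.tmul (E.j (E.i (supp m))) (hρ.coef (E.i (supp m))) (hρ.coef (ψ x m))) at h1
    rw [j_i, hj hx, hc hx, coef_i, PartialAction.tmul_one, coef_i_mul, hc hx, supp_mul_self] at h1
    rw [Units.val_one, Multiplier.app_one, ← h1]
  · refine Multiplier.units_ext (θ.isIdeal₂ x 1) fun m hm => ?_
    have hsm := (θ.isIdeal x).supp_mem hm.1
    have h1 := congrArg (fun p : θ.CrossedProduct w => (p.coef : A))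
      (hmul (ψ x m) (E.i (θ.map x⁻¹ (supp m))))
    simp only [PartialAction.CrossedProduct.coef_mul] at h1
    change hρ.coef (ψ x m * E.i (θ.map x⁻¹ (supp m))) =
      (w (E.j (ψ x m)) (E.j (E.i (θ.map x⁻¹ (supp m))))).val.app
      (θ.tmul (E.j (ψ x m)) (hρ.coef (ψ x m)) (hρ.coef (E.i (θ.map x⁻¹ (supp m))))) at h1
    rw [j_i, hρ.coef_mul_i hI, hj hm.1, hc hm.1, coef_i, θ.tmul_map hm.1 hsm, mul_supp_self] at h1
    rw [Units.val_one, Multiplier.app_one, ← h1]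

end IsOrderPreservingTransversal

end Refinement

end

end GroupExt

namespace PartialAction

section
variable {G : Type v} {A : Type u} [Group G] [CommSemigroup A] [IsInverseSemigroup A]
  {θ : PartialAction G A}

theorem equivalent_crossedExt {w : θ.C₂} [Fact (θ.IsTwisting w)] {E : GroupExt A G}
    (h : θ.IsCrossedProductExt w E) : E.Equivalent (crossedExt w) := by
  obtain ⟨e, hi, hj⟩ := h
  exact ⟨e, hi, fun p => (hj p).symm⟩

end

end PartialAction

theorem mainTheorem1 {G : Type v} {A : Type u} [Group G] [CommSemigroup A]
    [IsInverseSemigroup A] (θ : PartialAction G A) :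
    (∀ c : θ.H₂, ∃ w : θ.Z₂, θ.IsTwisting w ∧ PartialAction.H₂.mk θ w = c) ∧
    ∃ Φ : θ.H₂ ≃ θ.ExtClass,
      ∀ w : θ.Z₂, θ.IsTwisting w →
        ∃ E : θ.Ext, θ.IsCrossedProductExt w E.1 ∧
          Φ (PartialAction.H₂.mk θ w) = PartialAction.ExtClass.mk θ E := by
  refine ⟨PartialAction.exists_isTwisting_mk_eq, ?_⟩
  choose t ht hmk using PartialAction.exists_isTwisting_mk_eq (θ := θ)
  have ht' : ∀ c, Fact (θ.IsTwisting (t c)) := fun c => ⟨ht c⟩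
  let f : θ.H₂ → θ.ExtClass := fun c => PartialAction.ExtClass.mk θ (PartialAction.crossed (t c))
  -- `f` uses a chosen twisting in each class; this equivalence shows independence of the choice in
  -- one direction and injectivity in the other.
  have hf : ∀ (w : θ.Z₂) [Fact (θ.IsTwisting w)] (c : θ.H₂),
      f c = PartialAction.ExtClass.mk θ (PartialAction.crossed w.1) ↔
        c = PartialAction.H₂.mk θ w := fun w _ c => by
    conv_rhs => rw [← hmk c]
    rw [PartialAction.mk_eq_mk_iff, ← PartialAction.crossedExt_equivalent_iff]
    exact Quotient.eq
  have hbij : Function.Bijective f := by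
    constructor
    · intro c d h
      rw [← hmk d]
      exact (hf (t d) c).1 h
    · intro q
      obtain ⟨⟨E, R, ρ, hρ, hI⟩, rfl⟩ := Quotient.exists_rep q
      obtain ⟨w, hw, hE⟩ := hρ.exists_isTwisting hI
      have : Fact (θ.IsTwisting w) := ⟨hw⟩
      refine ⟨PartialAction.H₂.mk θ ⟨w, hw.1⟩, ((hf ⟨w, hw.1⟩ _).2 rfl).trans ?_⟩
      exact (Quotient.sound (PartialAction.equivalent_crossedExt hE)).symm
  refine ⟨Equiv.ofBijective f hbij, fun w hw => ?_⟩
  have : Fact (θ.IsTwisting w) := ⟨hw⟩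
  exact ⟨PartialAction.crossed w.1, PartialAction.isCrossedProductExt_crossedExt w.1,
    (hf w _).2 rfl⟩
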